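/- Consider $n\ge1$ spins, labelled by a finite set $V$ with $|V|=n$, with Hilbert space $(\mathbb C^q)^{\otimes V}$. Let $V$ carry a metric $\mathsf d$ such that, for some $d\ge 1$ and $A>0$, every closed ball of radius $r\ge1$ contains at most $A\,r^d$ spins. Fix $C>0$, $\xi>0$ and an integer $k\ge1$. Let $\omega=e^{-\beta H}/\mathrm{Tr}\,e^{-\beta H}$ be a Gibbs state of a Hamiltonian $H=H^\dagger$ ($\beta\in\mathbb R$) with correlation length $\xi$ and constant $C$: for any disjoint regions $\Lambda_1,\Lambda_2\subseteq V$ and any self-adjoint $h_1,h_2$ acting only on $\Lambda_1$ and $\Lambda_2$ respectively, $$\bigl|\mathrm{Tr}[\omega h_1h_2]-\mathrm{Tr}[\omega h_1]\,\mathrm{Tr}[\omega h_2]\bigr|\le C\,\|h_1\|\,\|h_2\|\,e^{-\mathsf d(\Lambda_1,\Lambda_2)/\xi},$$ where $\mathsf d(\Lambda_1,\Lambda_2)=\min_{x_1\in\Lambda_1,x_2\in\Lambda_2}\mathsf d(x_1,x_2)$ and $\|\cdot\|$ is the operator norm. For a self-adjoint operator $X$ let $$\|X\|_{\mathrm{loc}}=2\min\Bigl\{\max_{x\in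 V}\sum_{\Lambda\ni x}\|h_\Lambda\| : X=\sum_{\Lambda\subseteq V}h_\Lambda,\ h_\Lambda=h_\Lambda^\dagger\text{ acting only on }\Lambda\Bigr\},$$ and for a traceless self-adjoint $\Delta$ let $\|\Delta\|_{k\text{-}W_1\mathrm{loc}}$ be the maximum of $\mathrm{Tr}[\Delta X]$ over the self-adjoint $X$ with $\|X\|_{\mathrm{loc}}\le1$ that are $k$-local, i.e. sums of operators acting on at most $k$ spins each. For $x\ge0$ let $F(x)=\max_{s\ge0}s\left(x-e^s+1+\frac s2\right)$, let $s^*(x)$ be the unique maximizer, and for $w\ge0$ let $$f(w)=\frac{F(kw)}{k^2A^2\left[\frac{\xi}{kA^2}\bigl(k\,s^*(kw)+F(kw)\bigr)\right]^{\frac{2d}{2d+1}}}\,,\qquad f(0)=0.$$ Then $f$ is a strictly increasing bijection of $[0,\infty)$ onto itself. Let $S$ denote the von Neumann entropy (natural logarithm) and let $$c=\frac{\max\{\log(C+1),\,1/\xi\}}{n^{1/(2d+1)}}\,.$$ Then every quantum state $\rho$ with the same average energy as $\omega$, i.e. $\mathrm{Tr}[\rho H]=\mathrm{Tr}[\omega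 H]$, satisfies $\frac{S(\omega)-S(\rho)}{n^{1/(2d+1)}}+c\ge0$ and $$\frac1n\|\rho-\omega\|_{k\text{-}W_1\mathrm{loc}}\le f^{-1}\left(\frac{S(\omega)-S(\rho)}{n^{1/(2d+1)}}+c\right).$$ Moreover, let $\overline\rho=\frac1n\sum_{x\in V}\rho_x$ be the average of the single-spin marginals $\rho_x$ of $\rho$, and similarly $\overline\omega$. Then $$\frac12\|\overline\rho-\overline\omega\|_1\le f^{-1}\left(\frac{S(\omega)-S(\rho)}{n^{1/(2d+1)}}+c\right),$$ where $\|\cdot\|_1$ is the trace norm. -/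

import Mathlib

namespace SpinSystem

/-- Linear operators on `(ℂ^q)^{⊗V}`, as matrices in the computational basis, whose elements are
labelled by the configurations `V → Fin q`. For a region `Λ`, the operators on `H_Λ` are
`Op Λ q`. -/
abbrev Op (V : Type*) (q : ℕ) : Type _ := Matrix (V → Fin q) (V → Fin q) ℂ

section Operators

variable {V : Type*} [Fintype V] [DecidableEq V] {q : ℕ}

/-- The operator norm with respect to the Hilbert space norm. -/
noncomputable def opNorm (X : Op V q) : ℝ := ‖Matrix.toEuclideanCLM (𝕜 := ℂ) X‖

/-- `B ⊗ 1`, where `B` is an operator on the spins in `Λ` and `1` is the identity on the others. -/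
def embed (Λ : Finset V) (B : Op Λ q) : Op V q :=
  Matrix.of fun x y =>
    if ∀ v, v ∉ Λ → x v = y v then B (fun v => x v) (fun v => y v) else 0

/-- `X` acts only on the spins in `Λ`. -/
def ActsOn (Λ : Finset V) (X : Op V q) : Prop := ∃ B : Op Λ q, X = embed Λ B

/-- `X` is an observable (a self-adjoint operator) of the region `Λ`. -/
def IsObservableOn (Λ : Finset V) (X : Op V q) : Prop := X.IsHermitian ∧ ActsOn Λ X

/-- `X` is a sum of operators that act on at most `k` spins each. -/
def IsKLocal (k : ℕ) (X : Op V q) : Prop :=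
  ∃ Y : Finset V → Op V q, (∀ Λ, ActsOn Λ (Y Λ)) ∧
    X = ∑ Λ ∈ Finset.univ.filter (fun Λ : Finset V => Λ.card ≤ k), Y Λ

/-- The local norm: twice the minimum, over all the decompositions of `H` into observables of
regions, of the largest total operator norm of the terms that act on one spin. -/
noncomputable def locNorm (H : Op V q) : ℝ :=
  2 * sInf {r : ℝ | ∃ h : Finset V → Op V q, (∀ Λ, IsObservableOn Λ (h Λ)) ∧ H = ∑ Λ, h Λ ∧
    r = ⨆ x : V, ∑ Λ ∈ Finset.univ.filter (fun Λ : Finset V => x ∈ Λ), opNorm (h Λ)}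

/-- The `k`-local quantum `W₁` norm: the dual of the local norm on the `k`-local observables. -/
noncomputable def kW1loc (k : ℕ) (Δ : Op V q) : ℝ :=
  sSup {r : ℝ | ∃ H : Op V q, H.IsHermitian ∧ IsKLocal k H ∧ locNorm H ≤ 1 ∧
    r = (Matrix.trace (Δ * H)).re}

open scoped ComplexOrder in
/-- Quantum states (density matrices). -/
def IsState (ρ : Op V q) : Prop := ρ.PosSemidef ∧ ρ.trace = 1

/-- The Gibbs state `exp (-β H) / Tr (exp (-β H))`. -/
noncomputable def gibbs (β : ℝ) (H : Op V q) : Op V q :=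
  (Matrix.trace (NormedSpace.exp (-(β : ℂ) • H)))⁻¹ • NormedSpace.exp (-(β : ℂ) • H)

open Classical in
/-- The von Neumann entropy `-Tr (ρ log ρ) = -∑ λ log λ`, over the eigenvalues `λ` of `ρ`. -/
noncomputable def entropy (ρ : Op V q) : ℝ :=
  if h : ρ.IsHermitian then ∑ i, Real.negMulLog (h.eigenvalues i) else 0

/-- The marginal of `ρ` on the spin `x`, i.e. the partial trace over all the other spins. -/
noncomputable def marginal (ρ : Op V q) (x : V) : Matrix (Fin q) (Fin q) ℂ :=
  Matrix.of fun a b =>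
    ∑ u ∈ Finset.univ.filter (fun u : V → Fin q => u x = a), ρ u (Function.update u x b)

/-- The average of the single-spin marginals. -/
noncomputable def avgMarginal (ρ : Op V q) : Matrix (Fin q) (Fin q) ℂ :=
  ((Fintype.card V : ℂ))⁻¹ • ∑ x, marginal ρ x

end Operators

/-- The trace norm `Tr √(Xᴴ X)`, i.e. the sum of the singular values. -/
noncomputable def traceNorm {m : Type*} [Fintype m] [DecidableEq m] (X : Matrix m m ℂ) : ℝ :=
  ∑ i, √((Matrix.isHermitian_conjTranspose_mul_self X).eigenvalues i)

/-- The closed balls of radius `r` contain at most `A r ^ d` spins. Since every ball contains its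
centre, this can be asked only for radii bounded away from zero. -/
def BallGrowth (V : Type*) [Fintype V] [MetricSpace V] (A d : ℝ) : Prop :=
  ∀ (v : V) (r : ℝ), 1 ≤ r → ((Metric.closedBall v r).ncard : ℝ) ≤ A * r ^ d

/-- The distance between two nonempty regions. -/
noncomputable def regionDist {V : Type*} [MetricSpace V] (Λ₁ Λ₂ : Finset V) : ℝ :=
  sInf {r : ℝ | ∃ x ∈ Λ₁, ∃ y ∈ Λ₂, r = dist x y}

/-- The state `ω` has correlation length `ξ`, with constant `C`. (If one of the regions is empty,
the left-hand side vanishes.) -/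
def HasCorrelationLength {V : Type*} [Fintype V] [DecidableEq V] [MetricSpace V] {q : ℕ}
    (C ξ : ℝ) (ω : Op V q) : Prop :=
  ∀ (Λ₁ Λ₂ : Finset V) (h₁ h₂ : Op V q), Disjoint Λ₁ Λ₂ →
    IsObservableOn Λ₁ h₁ → IsObservableOn Λ₂ h₂ →
    ‖Matrix.trace (ω * (h₁ * h₂)) - Matrix.trace (ω * h₁) * Matrix.trace (ω * h₂)‖ ≤
      C * opNorm h₁ * opNorm h₂ * Real.exp (-(regionDist Λ₁ Λ₂) / ξ)

/-- The function `s ↦ s (x - e^s + 1 + s / 2)`. -/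
noncomputable def rate (x s : ℝ) : ℝ := s * (x - Real.exp s + 1 + s / 2)

/-- `F x = max_{s ≥ 0} s (x - e^s + 1 + s / 2)`. -/
noncomputable def F (x : ℝ) : ℝ := sSup (rate x '' Set.Ici 0)

/-- The maximiser (unique for `x ≥ 0`) of `s ↦ s (x - e^s + 1 + s / 2)` on `s ≥ 0`. -/
noncomputable def sStar (x : ℝ) : ℝ := sInf {s : ℝ | 0 ≤ s ∧ IsMaxOn (rate x) (Set.Ici 0) s}

/-- The function `f` of the transportation-cost inequality. -/
noncomputable def f (A d ξ : ℝ) (k : ℕ) (w : ℝ) : ℝ :=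
  F (k * w) / ((k : ℝ) ^ 2 * A ^ 2 *
    (ξ / (k * A ^ 2) * (k * sStar (k * w) + F (k * w))) ^ (2 * d / (2 * d + 1)))

/-- The inverse of `f` as a function from `[0, ∞)` to `[0, ∞)`. -/
noncomputable def fInv (A d ξ : ℝ) (k : ℕ) : ℝ → ℝ := Function.invFunOn (f A d ξ k) (Set.Ici 0)

end SpinSystem

/-! ### Trace inequalities for powers, the Lie product formula, Golden–Thompson. -/

section GoldenThompson

open Matrix Filter Topology
open scoped Matrix.Norms.L2Operator ComplexOrder MatrixOrder

variable {m : Type*} [Fintype m] [DecidableEq m]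

/-! The Gibbs variational principle applied to −βH + X, together with Golden–Thompson, gives Tr[ρX]
≤ S(ω) − S(ρ) + log Tr[ω e^X] for every self-adjoint X and every state ρ with the energy of ω
(`trace_mul_le_of_gibbs`). Everything then reduces to bounding the moment generating function, in
the state ω, of a sum of centred local terms.

For this bound (`re_trace_exp_le`) the power X^m is expanded into words in the local terms, and a
range r is fixed. If some region of a word is farther than r from all the others, its term commutes
with the rest and the decay of correlations bounds the word by C e^{-r/ξ} times the norms. In the
other words every region has a close partner, so the proximity graph has no isolated vertex and
decomposes into stars with at least two vertices (`exists_star`). Peeling off the star through the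
first letter gives a recursion for the total weight of these words (`noIsolatedWeight_succ_le`), and
a differential inequality sums its exponential generating function to exp(N₁/ℓ · t · (e^{Dℓt} − 1))
(`sum_div_factorial_le_exp`). Here D bounds the number of spins in a ball of radius r, ℓ bounds the
size of the regions, and N₁ is the total norm bound weighted by size.

Terms on more than ℓ spins are kept out of the exponential and bounded by their norm. The two
contributions add up to nt/ℓ (`mul_re_trace_sub_mul_le`), provided that Dℓt ≤ 2/3 and tn ≤ r/ξ.

The function f fits the choice of r, ℓ, t: if kw = (1+s)(e^s − 1), then s is the maximiser defining
F(kw), and t = s/(kD²), ℓ = k/(e^s − 1 − s/2) and r with r^{2d+1} proportional to n turn the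
estimate into n·w with f(w) the given argument (`parameters_spec`). Duality then gives the bound on
the k-local W₁ norm. Testing on half the sum of copies of one sign observable gives the bound on the
averaged marginals. -/

omit [DecidableEq m] in
theorem Matrix.re_trace_conjTranspose_mul_self (A : Matrix m m ℂ) :
    (Aᴴ * A).trace.re = ∑ i, ∑ j, ‖A j i‖ ^ 2 := by
  simp only [trace, diag_apply, mul_apply, conjTranspose_apply, Complex.re_sum]
  refine Finset.sum_congr rfl fun i _ => Finset.sum_congr rfl fun j _ => ?_
  rw [RCLike.star_def, ← Complex.normSq_eq_conj_mul_self, Complex.ofReal_re,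
    Complex.normSq_eq_norm_sq]

omit [DecidableEq m] in
theorem Matrix.norm_trace_mul_le (A B : Matrix m m ℂ) :
    ‖(A * B).trace‖ ≤ ((A * Aᴴ).trace.re + (Bᴴ * B).trace.re) / 2 := by
  rw [trace_mul_comm A Aᴴ, re_trace_conjTranspose_mul_self, re_trace_conjTranspose_mul_self,
    Finset.sum_comm, ← Finset.sum_add_distrib, Finset.sum_div, trace]
  refine (norm_sum_le _ _).trans (Finset.sum_le_sum fun i _ => ?_)
  rw [← Finset.sum_add_distrib, Finset.sum_div, diag_apply, mul_apply]
  refine (norm_sum_le _ _).trans (Finset.sum_le_sum fun j _ => ?_)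
  rw [norm_mul]
  nlinarith [sq_nonneg (‖A i j‖ - ‖B j i‖)]

theorem Matrix.trace_mul_pow_comm (A B : Matrix m m ℂ) (N : ℕ) :
    ((A * B) ^ N).trace = ((B * A) ^ N).trace := by
  cases N with
  | zero => simp
  | succ N =>
    have h : ∀ N : ℕ, (A * B) ^ (N + 1) = A * ((B * A) ^ N * B) := by
      intro N
      induction N with
      | zero => simp
      | succ N ih => rw [pow_succ', ih, pow_succ' (B * A)]; simp only [mul_assoc]
    rw [h, trace_mul_comm, mul_assoc, ← pow_succ]

theorem Matrix.PosSemidef.norm_trace_mul {P Q : Matrix m m ℂ} (hP : P.PosSemidef)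
    (hQ : Q.PosSemidef) : ‖(P * Q).trace‖ = (P * Q).trace.re := by
  obtain ⟨B, rfl⟩ : ∃ B : Matrix m m ℂ, P = Bᴴ * B :=
    CStarAlgebra.nonneg_iff_eq_star_mul_self.mp hP.nonneg
  have h := (hQ.mul_mul_conjTranspose_same B).trace_nonneg
  obtain ⟨hre, him⟩ := Complex.nonneg_iff.mp h
  rw [mul_assoc, trace_mul_comm, ← Complex.abs_re_eq_norm.mpr him.symm, abs_of_nonneg hre]

/-- The two families of inequalities are proved by a joint induction, since each step of one uses
the other. The first passes from Y to Y² and then compares (Y*Y)(YY*) with separate powers; the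
second applies the first to Y = PQ, where cyclicity turns (PQ)*(PQ) into P²Q². -/
theorem Matrix.norm_trace_pow_two_pow_le (j : ℕ) :
    (∀ Y : Matrix m m ℂ, ‖(Y ^ 2 ^ (j + 1)).trace‖ ≤ ((Yᴴ * Y) ^ 2 ^ j).trace.re) ∧
    ∀ P Q : Matrix m m ℂ, P.PosSemidef → Q.PosSemidef →
      ‖((P * Q) ^ 2 ^ j).trace‖ ≤ (P ^ 2 ^ j * Q ^ 2 ^ j).trace.re := by
  induction j with
  | zero =>
    refine ⟨fun Y => ?_, fun P Q hP hQ => by simpa using (hP.norm_trace_mul hQ).le⟩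
    have h := norm_trace_mul_le Y Y
    rw [trace_mul_comm Y Yᴴ] at h
    simpa [pow_two] using h
  | succ j ih =>
    obtain ⟨ih₁, ih₂⟩ := ih
    constructor
    · intro Y
      have h₁ := ih₁ (Y ^ 2)
      rw [← pow_mul, ← pow_succ'] at h₁
      refine h₁.trans ?_
      have h₂ : (((Y ^ 2)ᴴ * Y ^ 2) ^ 2 ^ j).trace = (((Yᴴ * Y) * (Y * Yᴴ)) ^ 2 ^ j).trace := by
        rw [pow_two, conjTranspose_mul, mul_assoc, trace_mul_pow_comm]
        simp only [mul_assoc]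
      rw [h₂]
      refine (Complex.re_le_norm _).trans ((ih₂ _ _ (posSemidef_conjTranspose_mul_self Y)
        (posSemidef_self_mul_conjTranspose Y)).trans ?_)
      -- Cauchy–Schwarz separates the powers of Y*Y and YY*, which have the same traces.
      refine (Complex.re_le_norm _).trans ((norm_trace_mul_le _ _).trans ?_)
      rw [conjTranspose_pow, conjTranspose_pow, (isHermitian_conjTranspose_mul_self Y).eq,
        (isHermitian_mul_conjTranspose_self Y).eq, ← pow_add, ← pow_add,
        trace_mul_pow_comm Y Yᴴ, ← two_mul (2 ^ j), ← pow_succ']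
      linarith
    · intro P Q hP hQ
      refine (ih₁ (P * Q)).trans ?_
      have h₂ : (((P * Q)ᴴ * (P * Q)) ^ 2 ^ j).trace = (((P ^ 2) * (Q ^ 2)) ^ 2 ^ j).trace := by
        rw [conjTranspose_mul, hP.1.eq, hQ.1.eq, mul_assoc, trace_mul_pow_comm]
        simp only [mul_assoc, pow_two]
      rw [h₂]
      refine (Complex.re_le_norm _).trans ((ih₂ _ _ (hP.pow 2) (hQ.pow 2)).trans ?_)
      rw [← pow_mul, ← pow_mul, ← pow_succ']

/-- Telescoping: each of the N + 1 replacements of a factor x by y costs at most c^N ‖x − y‖. -/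
theorem norm_pow_sub_pow_le {R : Type*} [NormedRing R] [NormOneClass R] (x y : R) (c : ℝ)
    (hx : ‖x‖ ≤ c) (hy : ‖y‖ ≤ c) (N : ℕ) :
    ‖x ^ (N + 1) - y ^ (N + 1)‖ ≤ (N + 1) * c ^ N * ‖x - y‖ := by
  have hc : 0 ≤ c := (norm_nonneg _).trans hx
  induction N with
  | zero => simp
  | succ N ih =>
    have h : x ^ (N + 1 + 1) - y ^ (N + 1 + 1)
        = x * (x ^ (N + 1) - y ^ (N + 1)) + (x - y) * y ^ (N + 1) := by
      rw [pow_succ' x (N + 1), pow_succ' y (N + 1)]; noncomm_ring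
    rw [h]
    have h₁ : ‖x * (x ^ (N + 1) - y ^ (N + 1))‖ ≤ c * ((N + 1) * c ^ N * ‖x - y‖) :=
      (norm_mul_le _ _).trans (mul_le_mul hx ih (norm_nonneg _) hc)
    have h₂ : ‖(x - y) * y ^ (N + 1)‖ ≤ ‖x - y‖ * c ^ (N + 1) :=
      (norm_mul_le _ _).trans (mul_le_mul_of_nonneg_left
        ((norm_pow_le _ _).trans (pow_le_pow_left₀ (norm_nonneg _) hy _)) (norm_nonneg _))
    refine (norm_add_le _ _).trans ((add_le_add h₁ h₂).trans (le_of_eq ?_))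
    push_cast; ring

theorem NormedSpace.norm_exp_le' {R : Type*} [NormedRing R] [NormOneClass R] [NormedAlgebra ℝ R]
    [CompleteSpace R] (x : R) : ‖NormedSpace.exp x‖ ≤ Real.exp ‖x‖ := by
  have h := NormedSpace.exp_series_hasSum_exp' (𝕂 := ℝ) x
  have h' := NormedSpace.exp_series_hasSum_exp' (𝕂 := ℝ) ‖x‖
  rw [← Real.exp_eq_exp_ℝ] at h'
  rw [← h.tsum_eq]
  refine tsum_of_norm_bounded h' fun n => ?_
  rw [norm_smul, norm_inv, smul_eq_mul]
  gcongr
  · simp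
  · exact norm_pow_le _ _

/-- The Lie product formula. -/
theorem NormedSpace.tendsto_exp_mul_exp_pow {R : Type*} [NormedRing R] [NormOneClass R]
    [NormedAlgebra ℝ R] [CompleteSpace R] (x y : R) :
    Tendsto (fun N : ℕ => (NormedSpace.exp ((N + 1 : ℝ)⁻¹ • x) *
      NormedSpace.exp ((N + 1 : ℝ)⁻¹ • y)) ^ (N + 1)) atTop (𝓝 (NormedSpace.exp (x + y))) := by
  let _ : NormedAlgebra ℚ R := NormedAlgebra.restrictScalars ℚ ℝ R
  let φ : ℝ → R := fun s => NormedSpace.exp (s • x) * NormedSpace.exp (s • y) -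
    NormedSpace.exp (s • (x + y))
  -- The two curves agree to first order at 0, so the error of one factor is o(1/N) and N factors
  -- accumulate o(1).
  have hφ : HasDerivAt φ 0 0 := by
    have h₁ := hasDerivAt_exp_smul_const (𝕂 := ℝ) x 0
    have h₂ := hasDerivAt_exp_smul_const (𝕂 := ℝ) y 0
    have h₃ := hasDerivAt_exp_smul_const (𝕂 := ℝ) (x + y) 0
    have h := (h₁.mul h₂).sub h₃
    have h0 : NormedSpace.exp ((0 : ℝ) • x) * x * NormedSpace.exp ((0 : ℝ) • y) +
        NormedSpace.exp ((0 : ℝ) • x) * (NormedSpace.exp ((0 : ℝ) • y) * y) -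
        NormedSpace.exp ((0 : ℝ) • (x + y)) * (x + y) = 0 := by simp
    rw [h0] at h
    exact h
  have hφ0 : φ 0 = 0 := by simp [φ]
  have ht : Tendsto (fun N : ℕ => ((N : ℝ) + 1)⁻¹) atTop (𝓝 0) := by
    simpa using tendsto_one_div_add_atTop_nhds_zero_nat (𝕜 := ℝ)
  have ho : Tendsto (fun N : ℕ => ((N : ℝ) + 1) * ‖φ ((N + 1 : ℝ)⁻¹)‖) atTop (𝓝 0) := by
    have h₁ := (hasDerivAt_iff_isLittleO.mp hφ).norm_norm
    simp only [hφ0, sub_zero, smul_zero] at h₁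
    have h₂ := (h₁.tendsto_div_nhds_zero).comp ht
    refine h₂.congr fun N => ?_
    have : (0 : ℝ) < N + 1 := by positivity
    simp only [Function.comp, norm_inv, Real.norm_eq_abs, abs_of_pos this]
    rw [div_inv_eq_mul, mul_comm]
  rw [tendsto_iff_norm_sub_tendsto_zero]
  have hE : Tendsto (fun N : ℕ => Real.exp (‖x‖ + ‖y‖) *
      (((N : ℝ) + 1) * ‖φ ((N + 1 : ℝ)⁻¹)‖)) atTop (𝓝 0) := by
    simpa using ho.const_mul (Real.exp (‖x‖ + ‖y‖))
  refine squeeze_zero (fun _ => norm_nonneg _) (fun N => ?_) hE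
  set τ : ℝ := (N + 1 : ℝ)⁻¹ with hτ
  have hN : (0 : ℝ) < N + 1 := by positivity
  have hτ0 : 0 < τ := by positivity
  have hexp : NormedSpace.exp (x + y) = NormedSpace.exp (τ • (x + y)) ^ (N + 1) := by
    rw [← NormedSpace.exp_nsmul, ← Nat.cast_smul_eq_nsmul ℝ, smul_smul]
    congr 1
    rw [hτ]; push_cast; rw [mul_inv_cancel₀ hN.ne', one_smul]
  rw [hexp]
  have hns : ∀ z : R, ‖τ • z‖ = τ * ‖z‖ := fun z => by
    rw [norm_smul, Real.norm_of_nonneg hτ0.le]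
  have hc₁ : ‖NormedSpace.exp (τ • x) * NormedSpace.exp (τ • y)‖ ≤
      Real.exp (τ * (‖x‖ + ‖y‖)) := by
    rw [mul_add, Real.exp_add, ← hns, ← hns]
    exact (norm_mul_le _ _).trans (mul_le_mul (NormedSpace.norm_exp_le' _)
      (NormedSpace.norm_exp_le' _) (norm_nonneg _) (Real.exp_nonneg _))
  have hc₂ : ‖NormedSpace.exp (τ • (x + y))‖ ≤ Real.exp (τ * (‖x‖ + ‖y‖)) := by
    refine (NormedSpace.norm_exp_le' _).trans (Real.exp_le_exp.mpr ?_)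
    rw [hns]
    exact mul_le_mul_of_nonneg_left (norm_add_le _ _) hτ0.le
  refine (norm_pow_sub_pow_le _ _ _ hc₁ hc₂ N).trans ?_
  have hpow : Real.exp (τ * (‖x‖ + ‖y‖)) ^ N ≤ Real.exp (‖x‖ + ‖y‖) := by
    rw [← Real.exp_nat_mul]
    refine Real.exp_le_exp.mpr ?_
    rw [← mul_assoc]
    have : (N : ℝ) * τ ≤ 1 := by rw [hτ, ← div_eq_mul_inv, div_le_one hN]; linarith
    exact mul_le_of_le_one_left (by positivity) this
  calc _ ≤ (N + 1 : ℝ) * Real.exp (‖x‖ + ‖y‖) * ‖φ τ‖ := by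
        gcongr
    _ = _ := by ring

theorem Matrix.posSemidef_exp {A : Matrix m m ℂ} (hA : A.IsHermitian) :
    (NormedSpace.exp A).PosSemidef := by
  have h : A = (2⁻¹ : ℂ) • A + (2⁻¹ : ℂ) • A := by rw [← add_smul]; norm_num
  have h' : ((2⁻¹ : ℂ) • A).IsHermitian := by
    rw [IsHermitian, conjTranspose_smul, hA.eq]; simp
  rw [h, Matrix.exp_add_of_commute _ _ (Commute.refl _)]
  have := posSemidef_conjTranspose_mul_self (NormedSpace.exp ((2⁻¹ : ℂ) • A))
  rwa [h'.exp.eq] at this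

/-- The Golden–Thompson inequality. -/
theorem Matrix.re_trace_exp_add_le [Nonempty m] {A B : Matrix m m ℂ} (hA : A.IsHermitian)
    (hB : B.IsHermitian) :
    (NormedSpace.exp (A + B)).trace.re ≤ (NormedSpace.exp A * NormedSpace.exp B).trace.re := by
  let _ : NormedAlgebra ℝ (Matrix m m ℂ) := NormedAlgebra.restrictScalars ℝ ℂ _
  have hlim := NormedSpace.tendsto_exp_mul_exp_pow A B
  -- The trace inequality is available only for exponents 2^j, so the Lie product is followed along
  -- N + 1 = 2^j.
  have hsub : Tendsto (fun j : ℕ => 2 ^ j - 1) atTop atTop :=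
    tendsto_atTop_mono (fun j => Nat.le_sub_one_of_lt j.lt_two_pow_self) tendsto_id
  have hlim' := hlim.comp hsub
  have hcont : Continuous fun M : Matrix m m ℂ => M.trace.re :=
    Complex.continuous_re.comp (continuous_id.matrix_trace)
  refine le_of_tendsto ((hcont.tendsto _).comp hlim') (Eventually.of_forall fun j => ?_)
  have h2 : 2 ^ j - 1 + 1 = 2 ^ j := Nat.sub_add_cancel Nat.one_le_two_pow
  have h2' : ((2 ^ j - 1 : ℕ) : ℝ) + 1 = 2 ^ j := by exact_mod_cast congrArg (Nat.cast (R := ℝ)) h2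
  simp only [Function.comp, h2, h2']
  have hs : ∀ M : Matrix m m ℂ, M.IsHermitian → (((2 : ℝ) ^ j)⁻¹ • M).IsHermitian := fun M hM => by
    rw [IsHermitian, conjTranspose_smul, hM.eq]; simp
  have hp : ∀ M : Matrix m m ℂ, NormedSpace.exp (((2 : ℝ) ^ j)⁻¹ • M) ^ 2 ^ j =
      NormedSpace.exp M := fun M => by
    rw [← Matrix.exp_nsmul, ← Nat.cast_smul_eq_nsmul ℝ, smul_smul]
    simp
  have h := (norm_trace_pow_two_pow_le j).2 _ _ (posSemidef_exp (hs A hA)) (posSemidef_exp (hs B hB))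
  rw [hp, hp] at h
  exact (Complex.re_le_norm _).trans h

end GoldenThompson

/-! ### Spectral calculus, entropy and the Gibbs variational principle. -/

section Gibbs

open Matrix
open scoped Matrix.Norms.L2Operator ComplexOrder MatrixOrder

variable {m : Type*} [Fintype m] [DecidableEq m]

theorem Matrix.IsHermitian.exists_eq_unitary_diagonal {A : Matrix m m ℂ} (hA : A.IsHermitian) :
    ∃ U : Matrix m m ℂ, Uᴴ * U = 1 ∧ U * Uᴴ = 1 ∧
      A = U * diagonal (fun i => (hA.eigenvalues i : ℂ)) * Uᴴ :=
  ⟨hA.eigenvectorUnitary, Unitary.coe_star_mul_self _, Unitary.coe_mul_star_self _,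
    hA.spectral_theorem⟩

/-- A function of the spectrum can be computed in any diagonalization. -/
theorem Matrix.IsHermitian.sum_eigenvalues_eq {U A : Matrix m m ℂ} {p : m → ℝ}
    (hU : Uᴴ * U = 1) (hA : A.IsHermitian) (h : A = U * diagonal (fun i => (p i : ℂ)) * Uᴴ)
    (φ : ℝ → ℝ) : ∑ i, φ (hA.eigenvalues i) = ∑ i, φ (p i) := by
  have h₁ : A.charpoly = (diagonal (fun i => (p i : ℂ))).charpoly := by
    rw [h, charpoly_mul_comm, ← mul_assoc, hU, one_mul]
  have h₂ := hA.roots_charpoly_eq_eigenvalues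
  rw [h₁, charpoly_diagonal, Polynomial.roots_prod _ _
    (Finset.prod_ne_zero_iff.mpr fun i _ => Polynomial.X_sub_C_ne_zero _)] at h₂
  simp only [Polynomial.roots_X_sub_C, Multiset.bind_singleton] at h₂
  have h₃ := congrArg (fun s : Multiset ℂ => (s.map fun z => φ z.re).sum) h₂
  simp only [Multiset.map_map, Function.comp_def] at h₃
  simpa using h₃.symm

theorem Matrix.exp_unitary_diagonal {U : Matrix m m ℂ} (hU : Uᴴ * U = 1) (hU' : U * Uᴴ = 1)
    (κ : m → ℝ) : NormedSpace.exp (U * diagonal (fun i => (κ i : ℂ)) * Uᴴ) =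
      U * diagonal (fun i => (Real.exp (κ i) : ℂ)) * Uᴴ := by
  have hinv : U⁻¹ = Uᴴ := inv_eq_left_inv hU
  have hu : IsUnit U := ⟨⟨U, Uᴴ, hU', hU⟩, rfl⟩
  rw [← hinv, Matrix.exp_conj _ _ hu, Matrix.exp_diagonal]
  congr 3
  funext i
  rw [Pi.coe_exp]
  simp [Complex.exp_eq_exp_ℂ]

theorem Matrix.norm_entry_le (A : Matrix m m ℂ) (i j : m) : ‖A i j‖ ≤ ‖A‖ := by
  have h := l2_opNorm_mulVec A (EuclideanSpace.single j 1)
  rw [PiLp.norm_single, norm_one, mul_one] at h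
  refine le_trans ?_ h
  refine le_trans (le_of_eq ?_) (PiLp.norm_apply_le _ i)
  simp

theorem Matrix.norm_le_one_of_unitary {U : Matrix m m ℂ} (hU : Uᴴ * U = 1) : ‖U‖ ≤ 1 := by
  have h := l2_opNorm_conjTranspose_mul_self U
  rw [hU] at h
  have h1 : ‖(1 : Matrix m m ℂ)‖ ≤ 1 := by
    rw [← diagonal_one, l2_opNorm_diagonal]
    exact (pi_norm_le_iff_of_nonneg zero_le_one).mpr fun i => by simp
  nlinarith [norm_nonneg U]

theorem Matrix.trace_unitary_diagonal_mul (U X : Matrix m m ℂ) (p : m → ℝ) :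
    (U * diagonal (fun i => (p i : ℂ)) * Uᴴ * X).trace = ∑ i, (p i : ℂ) * (Uᴴ * X * U) i i := by
  rw [mul_assoc, mul_assoc, trace_mul_comm, mul_assoc, trace]
  simp only [diag_apply, diagonal_mul, mul_assoc]

namespace SpinSystem

variable {V : Type*} [Fintype V] [DecidableEq V] {q : ℕ}

theorem opNorm_eq_norm (X : Op V q) : opNorm X = ‖X‖ := rfl

/-- A state is a convex combination of orthogonal pure states. -/
theorem IsState.exists_diagonal {ρ : Op V q} (hρ : IsState ρ) :
    ∃ (U : Op V q) (p : (V → Fin q) → ℝ), Uᴴ * U = 1 ∧ U * Uᴴ = 1 ∧ (∀ i, 0 ≤ p i) ∧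
      ∑ i, p i = 1 ∧ ρ = U * diagonal (fun i => (p i : ℂ)) * Uᴴ := by
  obtain ⟨U, hU, hU', h⟩ := hρ.1.1.exists_eq_unitary_diagonal
  refine ⟨U, _, hU, hU', hρ.1.eigenvalues_nonneg, ?_, h⟩
  have h₁ := hρ.2
  rw [hρ.1.1.trace_eq_sum_eigenvalues] at h₁
  simpa using congrArg Complex.re h₁

theorem entropy_eq {U ρ : Op V q} {p : (V → Fin q) → ℝ} (hU : Uᴴ * U = 1)
    (h : ρ = U * diagonal (fun i => (p i : ℂ)) * Uᴴ) :
    entropy ρ = ∑ i, Real.negMulLog (p i) := by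
  have hρ : ρ.IsHermitian := by
    rw [IsHermitian, h, conjTranspose_mul, conjTranspose_mul, diagonal_conjTranspose,
      conjTranspose_conjTranspose, mul_assoc]
    congr 3
    funext i
    simp
  rw [entropy, dif_pos hρ]
  convert hρ.sum_eigenvalues_eq hU h Real.negMulLog

theorem IsState.norm_trace_mul_le {ρ : Op V q} (hρ : IsState ρ) (X : Op V q) :
    ‖(ρ * X).trace‖ ≤ opNorm X := by
  obtain ⟨U, p, hU, hU', hp, hp1, rfl⟩ := hρ.exists_diagonal
  rw [trace_unitary_diagonal_mul, opNorm_eq_norm]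
  have hn : ∀ i, ‖(Uᴴ * X * U) i i‖ ≤ ‖X‖ := fun i => by
    refine (norm_entry_le _ i i).trans ?_
    have h₁ := norm_le_one_of_unitary hU
    have h₂ : ‖Uᴴ‖ ≤ 1 := by rwa [l2_opNorm_conjTranspose]
    calc ‖Uᴴ * X * U‖ ≤ ‖Uᴴ * X‖ * ‖U‖ := norm_mul_le _ _
      _ ≤ ‖Uᴴ‖ * ‖X‖ * ‖U‖ := by gcongr; exact norm_mul_le _ _
      _ ≤ 1 * ‖X‖ * 1 := by gcongr
      _ = ‖X‖ := by ring
  calc _ ≤ ∑ i, ‖(p i : ℂ) * (Uᴴ * X * U) i i‖ := norm_sum_le _ _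
    _ ≤ ∑ i, p i * ‖X‖ := Finset.sum_le_sum fun i _ => by
        rw [norm_mul, Complex.norm_of_nonneg (hp i)]
        exact mul_le_mul_of_nonneg_left (hn i) (hp i)
    _ = ‖X‖ := by rw [← Finset.sum_mul, hp1, one_mul]

/-- The scalar Gibbs inequality: x + 1 ≤ e^x at x = a − log p, multiplied by p. -/
theorem mul_add_negMulLog_le {p : ℝ} (hp : 0 ≤ p) (a : ℝ) :
    p * a + Real.negMulLog p ≤ Real.exp a - p := by
  rcases hp.eq_or_lt with rfl | hp
  · simp [Real.exp_nonneg]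
  · have h := Real.add_one_le_exp (a - Real.log p)
    rw [Real.exp_sub, Real.exp_log hp] at h
    have h' := mul_le_mul_of_nonneg_left h hp.le
    rw [mul_div_cancel₀ _ hp.ne'] at h'
    rw [Real.negMulLog]
    nlinarith

/-- The Gibbs variational principle. -/
theorem IsState.entropy_add_trace_le [Nonempty V] {ρ K : Op V q} (hρ : IsState ρ)
    (hK : K.IsHermitian) :
    entropy ρ + (ρ * K).trace.re ≤ Real.log (NormedSpace.exp K).trace.re := by
  obtain ⟨U, p, hU, hU', hp, hp1, h⟩ := hρ.exists_diagonal
  obtain ⟨W, hW, hW', hKW⟩ := hK.exists_eq_unitary_diagonal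
  set κ := hK.eigenvalues
  have hne : (Finset.univ : Finset (V → Fin q)).Nonempty := by
    rw [Finset.nonempty_iff_ne_empty]
    intro h0
    rw [h0, Finset.sum_empty] at hp1
    exact zero_ne_one hp1
  have htr : (NormedSpace.exp K).trace.re = ∑ j, Real.exp (κ j) := by
    rw [hKW, exp_unitary_diagonal hW hW', mul_assoc, trace_mul_comm, mul_assoc, hW, mul_one,
      trace_diagonal]
    rw [Complex.re_sum]
    exact Finset.sum_congr rfl fun i _ => Complex.ofReal_re _
  set Z := ∑ j, Real.exp (κ j)
  have hZ : 0 < Z := Finset.sum_pos (fun i _ => Real.exp_pos _) hne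
  -- The squared overlaps of the eigenbases of ρ and K form a doubly stochastic matrix; averaging
  -- over it reduces the claim to the scalar inequality.
  let D : (V → Fin q) → (V → Fin q) → ℝ := fun i j => Complex.normSq ((Uᴴ * W) i j)
  have hD₁ : ∀ i, ∑ j, D i j = 1 := fun i => by
    have h1 : (Uᴴ * W) * (Uᴴ * W)ᴴ = 1 := by
      rw [conjTranspose_mul, conjTranspose_conjTranspose, mul_assoc, ← mul_assoc W, hW', one_mul,
        hU]
    have h2 := congrFun (congrFun h1 i) i
    rw [mul_apply, one_apply_eq] at h2
    have h3 : ((∑ j, D i j : ℝ) : ℂ) = 1 := by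
      rw [← h2]; push_cast
      exact Finset.sum_congr rfl fun j _ => by
        rw [conjTranspose_apply, RCLike.star_def, Complex.mul_conj]
    exact_mod_cast h3
  have hD₂ : ∀ j, ∑ i, D i j = 1 := fun j => by
    have h1 : (Uᴴ * W)ᴴ * (Uᴴ * W) = 1 := by
      rw [conjTranspose_mul, conjTranspose_conjTranspose, mul_assoc, ← mul_assoc U, hU', one_mul,
        hW]
    have h2 := congrFun (congrFun h1 j) j
    rw [mul_apply, one_apply_eq] at h2
    have h3 : ((∑ i, D i j : ℝ) : ℂ) = 1 := by
      rw [← h2]; push_cast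
      exact Finset.sum_congr rfl fun j _ => by
        rw [conjTranspose_apply, RCLike.star_def, mul_comm, Complex.mul_conj]
    exact_mod_cast h3
  have hρK : (ρ * K).trace.re = ∑ i, ∑ j, D i j * (p i * κ j) := by
    rw [h, trace_unitary_diagonal_mul, Complex.re_sum]
    refine Finset.sum_congr rfl fun i _ => ?_
    have h4 : (Uᴴ * K * U) i i = ∑ j, ((D i j * κ j : ℝ) : ℂ) := by
      have h5 : Uᴴ * K * U = (Uᴴ * W) * diagonal (fun i => (κ i : ℂ)) * (Uᴴ * W)ᴴ := by
        rw [hKW, conjTranspose_mul, conjTranspose_conjTranspose]; simp only [mul_assoc]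
      rw [h5, mul_apply]
      refine Finset.sum_congr rfl fun j _ => ?_
      rw [mul_diagonal, conjTranspose_apply, RCLike.star_def, mul_right_comm, Complex.mul_conj]
      push_cast; rfl
    rw [h4, ← Complex.ofReal_sum, ← Complex.ofReal_mul, Complex.ofReal_re, Finset.mul_sum]
    exact Finset.sum_congr rfl fun j _ => by ring
  have hS : entropy ρ = ∑ i, ∑ j, D i j * Real.negMulLog (p i) := by
    rw [entropy_eq hU h]
    exact Finset.sum_congr rfl fun i _ => by rw [← Finset.sum_mul, hD₁, one_mul]
  have hL : Real.log Z = ∑ i, ∑ j, D i j * (p i * Real.log Z) := by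
    have : ∀ i, ∑ j, D i j * (p i * Real.log Z) = p i * Real.log Z := fun i => by
      rw [← Finset.sum_mul, hD₁, one_mul]
    simp only [this]
    rw [← Finset.sum_mul, hp1, one_mul]
  have hE₁ : ∑ i, ∑ j, D i j * (Real.exp (κ j) / Z) = 1 := by
    rw [Finset.sum_comm]
    have : ∀ j, ∑ i, D i j * (Real.exp (κ j) / Z) = Real.exp (κ j) / Z := fun j => by
      rw [← Finset.sum_mul, hD₂, one_mul]
    simp only [this]
    rw [← Finset.sum_div, div_self hZ.ne']
  have hE₂ : ∑ i, ∑ j, D i j * p i = 1 := by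
    have : ∀ i, ∑ j, D i j * p i = p i := fun i => by rw [← Finset.sum_mul, hD₁, one_mul]
    simp only [this, hp1]
  -- With a = κ_j − log Z, the right-hand side averages to 1 − 1 = 0.
  have key : ∑ i, ∑ j, D i j * (p i * (κ j - Real.log Z) + Real.negMulLog (p i)) ≤
      ∑ i, ∑ j, D i j * (Real.exp (κ j) / Z - p i) := by
    refine Finset.sum_le_sum fun i _ => Finset.sum_le_sum fun j _ =>
      mul_le_mul_of_nonneg_left ?_ (Complex.normSq_nonneg _)
    have := mul_add_negMulLog_le (hp i) (κ j - Real.log Z)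
    rwa [Real.exp_sub, Real.exp_log hZ] at this
  simp only [mul_add, mul_sub, Finset.sum_add_distrib, Finset.sum_sub_distrib] at key
  rw [hE₁, hE₂, ← hρK, ← hS, ← hL] at key
  rw [htr]
  linarith

theorem gibbs_eq_smul (β : ℝ) (H : Op V q) : gibbs β H =
    (Matrix.trace (NormedSpace.exp ((-β : ℝ) • H)))⁻¹ • NormedSpace.exp ((-β : ℝ) • H) := by
  have : (-(β : ℂ)) • H = (-β : ℝ) • H := by
    rw [← Complex.ofReal_neg]; rfl
  rw [gibbs, this]

omit [Fintype V] [DecidableEq V] in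
theorem isHermitian_real_smul {H : Op V q} (hH : H.IsHermitian) (b : ℝ) : (b • H).IsHermitian := by
  rw [IsHermitian, conjTranspose_smul, hH.eq]; simp

theorem exp_trace_pos [Nonempty (V → Fin q)] {K : Op V q} (hK : K.IsHermitian) :
    ∃ (U : Op V q) (κ : (V → Fin q) → ℝ), Uᴴ * U = 1 ∧ U * Uᴴ = 1 ∧
      K = U * diagonal (fun i => (κ i : ℂ)) * Uᴴ ∧
      (NormedSpace.exp K).trace = ((∑ i, Real.exp (κ i) : ℝ) : ℂ) ∧ 0 < ∑ i, Real.exp (κ i) := by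
  obtain ⟨W, hW, hW', hKW⟩ := hK.exists_eq_unitary_diagonal
  refine ⟨W, _, hW, hW', hKW, ?_, Finset.sum_pos (fun i _ => Real.exp_pos _) Finset.univ_nonempty⟩
  conv_lhs => rw [hKW]
  rw [exp_unitary_diagonal hW hW', mul_assoc, trace_mul_comm, mul_assoc, hW, mul_one,
      trace_diagonal]
  push_cast; rfl

theorem isState_gibbs [Nonempty (V → Fin q)] {H : Op V q} (hH : H.IsHermitian) (β : ℝ) :
    IsState (gibbs β H) := by
  rw [gibbs_eq_smul]
  obtain ⟨U, κ, hU, hU', h, hZ, hpos⟩ := exp_trace_pos (isHermitian_real_smul hH (-β))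
  rw [hZ]
  constructor
  · refine (posSemidef_exp (isHermitian_real_smul hH (-β))).smul ?_
    rw [← Complex.ofReal_inv]
    exact_mod_cast (inv_pos.mpr hpos).le
  · rw [trace_smul, hZ, smul_eq_mul, inv_mul_cancel₀]
    exact_mod_cast hpos.ne'

theorem entropy_gibbs [Nonempty (V → Fin q)] {H : Op V q} (hH : H.IsHermitian) (β : ℝ) :
    entropy (gibbs β H) = Real.log (NormedSpace.exp ((-β : ℝ) • H)).trace.re +
      β * (gibbs β H * H).trace.re := by
  obtain ⟨U, κ, hU, hU', h, hZ, hpos⟩ := exp_trace_pos (isHermitian_real_smul hH (-β))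
  set Z := ∑ i, Real.exp (κ i)
  have hg : gibbs β H = U * diagonal (fun i => ((Real.exp (κ i) / Z : ℝ) : ℂ)) * Uᴴ := by
    rw [gibbs_eq_smul, hZ, h, exp_unitary_diagonal hU hU', ← Matrix.smul_mul, ← Matrix.mul_smul,
      ← diagonal_smul]
    congr 3
    funext i
    simp [div_eq_inv_mul]
  have hβ : β * (gibbs β H * H).trace.re = -(gibbs β H * ((-β : ℝ) • H)).trace.re := by
    rw [Matrix.mul_smul, trace_smul]; simp
  rw [hβ, entropy_eq hU hg, hZ, Complex.ofReal_re, hg, h, trace_unitary_diagonal_mul,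
    Complex.re_sum]
  have h1 : ∀ i, (Uᴴ * (U * diagonal (fun i => (κ i : ℂ)) * Uᴴ) * U) i i = (κ i : ℂ) := fun i => by
    have : Uᴴ * (U * diagonal (fun i => (κ i : ℂ)) * Uᴴ) * U = diagonal (fun i => (κ i : ℂ)) := by
      simp only [mul_assoc, hU, mul_one]
      rw [← mul_assoc, hU, one_mul]
    rw [this, diagonal_apply_eq]
  simp only [h1, ← Complex.ofReal_mul, Complex.ofReal_re]
  have h2 : ∀ i, Real.negMulLog (Real.exp (κ i) / Z) =
      Real.exp (κ i) / Z * Real.log Z - Real.exp (κ i) / Z * κ i := fun i => by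
    rw [Real.negMulLog, Real.log_div (Real.exp_ne_zero _) hpos.ne', Real.log_exp]; ring
  simp only [h2, Finset.sum_sub_distrib]
  rw [← Finset.sum_mul, ← Finset.sum_div, div_self hpos.ne']
  ring

/-- The relative entropy of a state of the same energy with respect to a Gibbs state controls the
expectation values of the observables. -/
theorem trace_mul_le_of_gibbs [Nonempty V] {H ρ X : Op V q} (hH : H.IsHermitian) (β : ℝ)
    (hρ : IsState ρ) (henergy : (ρ * H).trace = (gibbs β H * H).trace) (hX : X.IsHermitian) :
    0 < (gibbs β H * NormedSpace.exp X).trace.re ∧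
      (ρ * X).trace.re ≤ entropy (gibbs β H) - entropy ρ +
        Real.log (gibbs β H * NormedSpace.exp X).trace.re := by
  have : Nonempty (V → Fin q) := by
    by_contra h0
    rw [not_nonempty_iff] at h0
    have := hρ.2
    simp [trace] at this
  have hK := isHermitian_real_smul hH (-β)
  obtain ⟨U, κ, hU, hU', h, hZ, hpos⟩ := exp_trace_pos hK
  obtain ⟨U', κ', -, -, -, hZ', hpos'⟩ := exp_trace_pos (hK.add hX)
  -- The variational principle at −βH + X leaves a log-partition function, which Golden–Thompson
  -- bounds by log Z + log Tr[ω e^X]. The equality of energies cancels the β-terms against those in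
  -- the entropy of ω.
  have h₁ := hρ.entropy_add_trace_le (hK.add hX)
  have h₂ := re_trace_exp_add_le hK hX
  have h₃ : (NormedSpace.exp ((-β : ℝ) • H) * NormedSpace.exp X).trace.re =
      (NormedSpace.exp ((-β : ℝ) • H)).trace.re * (gibbs β H * NormedSpace.exp X).trace.re := by
    rw [gibbs_eq_smul, Matrix.smul_mul, trace_smul, hZ, ← Complex.ofReal_inv, smul_eq_mul,
      Complex.re_ofReal_mul, Complex.ofReal_re, mul_inv_cancel_left₀ hpos.ne']
  have hpos'' : 0 < (NormedSpace.exp ((-β : ℝ) • H + X)).trace.re := by rw [hZ']; exact hpos'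
  rw [h₃] at h₂
  have hpos₁ : 0 < (NormedSpace.exp ((-β : ℝ) • H)).trace.re := by rw [hZ]; exact hpos
  have hpos₂ : 0 < (gibbs β H * NormedSpace.exp X).trace.re :=
    pos_of_mul_pos_right (hpos''.trans_le h₂) hpos₁.le
  have h₄ := Real.log_le_log hpos'' h₂
  rw [Real.log_mul hpos₁.ne' hpos₂.ne'] at h₄
  rw [mul_add, trace_add, Complex.add_re, Matrix.mul_smul, trace_smul, henergy] at h₁
  have h₅ : ((-β : ℝ) • (gibbs β H * H).trace).re = -β * (gibbs β H * H).trace.re := by simp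
  rw [h₅] at h₁
  rw [entropy_gibbs hH]
  exact ⟨hpos₂, by linarith⟩

end SpinSystem

end Gibbs

/-! ### Star decompositions of graphs without isolated vertices, and their weights. -/

section StarForests

open Finset

/-- In a graph without isolated vertices, every vertex belongs to a star whose removal leaves no
isolated vertices. -/
theorem exists_star {ι : Type*} [Fintype ι] [DecidableEq ι] (r : ι → ι → Prop)
    (hs : ∀ i j, r i j → r j i) (h : ∀ i, ∃ j, j ≠ i ∧ r i j) (v : ι) :
    ∃ B : Finset ι, v ∈ B ∧ B ≠ {v} ∧ (∃ c ∈ B, ∀ i ∈ B, i ≠ c → r c i) ∧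
      ∀ i, i ∉ B → ∃ j, j ∉ B ∧ j ≠ i ∧ r i j := by
  classical
  -- If some vertex has v as its only neighbour, the star consists of v and all such leaves. A
  -- vertex outside keeps a neighbour other than v, which cannot be one of the leaves.
  by_cases hp : ∃ z, z ≠ v ∧ ∀ j, j ≠ z → r z j → j = v
  · let B : Finset ι := univ.filter fun z => z = v ∨ ∀ j, j ≠ z → r z j → j = v
    have hB : ∀ z, z ∈ B ↔ z = v ∨ ∀ j, j ≠ z → r z j → j = v := fun z => by simp [B]
    obtain ⟨z, hz, hz'⟩ := hp
    refine ⟨B, (hB v).mpr (Or.inl rfl), ?_, ⟨v, (hB v).mpr (Or.inl rfl), ?_⟩, ?_⟩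
    · intro hBv
      have : z ∈ B := (hB z).mpr (Or.inr hz')
      rw [hBv, mem_singleton] at this
      exact hz this
    · intro i hi hiv
      obtain ⟨j, hj, hij⟩ := h i
      have := ((hB i).mp hi).resolve_left hiv j hj hij
      exact hs _ _ (this ▸ hij)
    · intro i hi
      rw [hB] at hi
      push Not at hi
      obtain ⟨hiv, j, hj, hij, hjv⟩ := hi
      refine ⟨j, fun hjB => ?_, hj, hij⟩
      exact hiv (((hB j).mp hjB).resolve_left hjv i hj.symm (hs _ _ hij))
  · push Not at hp
    obtain ⟨u, hu, hvu⟩ := h v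
    -- If no leaf hangs on v, the star is centred at a neighbour u of v and takes along every
    -- neighbour of u that has no neighbours besides u and v. A vertex isolated by the removal would
    -- have neighbours only in {u, v}, and not only v, hence would already be in the star.
    let B : Finset ι := univ.filter fun z => z = u ∨ z = v ∨
      (r z u ∧ ∀ j, j ≠ z → r z j → j = u ∨ j = v)
    have hB : ∀ z, z ∈ B ↔ z = u ∨ z = v ∨
      (r z u ∧ ∀ j, j ≠ z → r z j → j = u ∨ j = v) := fun z => by simp [B]
    refine ⟨B, (hB v).mpr (by simp), ?_, ⟨u, (hB u).mpr (by simp), ?_⟩, ?_⟩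
    · intro hBv
      have : u ∈ B := (hB u).mpr (by simp)
      rw [hBv, mem_singleton] at this
      exact hu this
    · intro i hi hiu
      rcases (hB i).mp hi with rfl | rfl | ⟨hiu, -⟩
      · exact absurd rfl hiu
      · exact hs _ _ hvu
      · exact hs _ _ hiu
    · intro i hi
      by_contra hcon
      push Not at hcon
      have hi' := mt (hB i).mpr hi
      push Not at hi'
      obtain ⟨hiu, hiv, hi'⟩ := hi'
      have hN : ∀ j, j ≠ i → r i j → j = u ∨ j = v := by
        intro j hj hij
        have hjB : j ∈ B := by
          by_contra hjB
          exact hcon j hjB hj hij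
        rcases (hB j).mp hjB with h1 | h1 | ⟨-, h1⟩
        · exact Or.inl h1
        · exact Or.inr h1
        · rcases h1 i hj.symm (hs _ _ hij) with h2 | h2
          · exact absurd h2 hiu
          · exact absurd h2 hiv
      obtain ⟨j, hj, hij, hjv⟩ := hp i hiv
      have hju := (hN j hj hij).resolve_right hjv
      obtain ⟨j', hj', hij', h3, h4⟩ := hi' (hju ▸ hij)
      rcases hN j' hj' hij' with h5 | h5
      · exact h3 h5
      · exact h4 h5

variable {R : Type*} [Fintype R]

/-- No member of the family `f` is unrelated to all the other members. -/
def NoIsolated (r : R → R → Prop) {ι : Type*} (f : ι → R) : Prop :=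
  ∀ i, ∃ j, j ≠ i ∧ r (f i) (f j)

open Classical in
/-- The total weight of the families, indexed by `ι`, without isolated members. -/
noncomputable def noIsolatedWeight (a : R → ℝ) (r : R → R → Prop) (ι : Type) [Fintype ι] : ℝ :=
  ∑ f : ι → R, if NoIsolated r f then ∏ i, a (f i) else 0

theorem noIsolatedWeight_congr (a : R → ℝ) (r : R → R → Prop) {ι κ : Type} [Fintype ι] [Fintype κ]
    (e : ι ≃ κ) : noIsolatedWeight a r ι = noIsolatedWeight a r κ := by
  classical
  refine Fintype.sum_equiv (e.arrowCongr (Equiv.refl R)) _ _ fun f => ?_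
  have h₁ : NoIsolated r f ↔ NoIsolated r (e.arrowCongr (Equiv.refl R) f) := by
    simp only [NoIsolated, Equiv.arrowCongr_apply, Equiv.coe_refl, Function.comp, id]
    constructor
    · intro h i
      obtain ⟨j, hj, hr⟩ := h (e.symm i)
      exact ⟨e j, fun h' => hj (by rw [← h', e.symm_apply_apply]), by simpa using hr⟩
    · intro h i
      obtain ⟨j, hj, hr⟩ := h (e i)
      exact ⟨e.symm j, fun h' => hj (by rw [← h', e.apply_symm_apply]), by simpa using hr⟩
  have h₂ : ∏ i, a (f i) = ∏ i, a (e.arrowCongr (Equiv.refl R) f i) :=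
    Fintype.prod_equiv e _ _ fun i => by simp
  rw [h₂]
  simp only [h₁]

theorem noIsolatedWeight_nonneg {a : R → ℝ} (ha : ∀ x, 0 ≤ a x) (r : R → R → Prop) (ι : Type)
    [Fintype ι] : 0 ≤ noIsolatedWeight a r ι :=
  sum_nonneg fun f _ => by
    split_ifs
    · exact prod_nonneg fun i _ => ha _
    · exact le_rfl

theorem sum_restrict_mul_restrict {ι : Type*} [Fintype ι] [DecidableEq ι] (p : ι → Prop)
    [DecidablePred p] (F : ({i // p i} → R) → ℝ) (G : ({i // ¬p i} → R) → ℝ) :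
    ∑ f : ι → R, F (fun i => f i) * G (fun i => f i) = (∑ f, F f) * ∑ g, G g := by
  rw [sum_mul_sum, ← Fintype.sum_prod_type']
  exact Fintype.sum_equiv (Equiv.piEquivPiSubtypeProd p fun _ => R) _ _ fun f => rfl

open Classical in
-- Once the value x of the centre is fixed, the leaves are summed independently, each giving at most
-- `κ x`.
theorem sum_star_weight_le {a : R → ℝ} (ha : ∀ x, 0 ≤ a x) (r : R → R → Prop) {ι : Type*}
    [Fintype ι] [DecidableEq ι] (c : ι) (κ : R → ℝ)
    (hκ : ∀ x, ∑ y ∈ univ.filter (r x), a y ≤ κ x) :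
    ∑ f : ι → R, (if ∀ i, i ≠ c → r (f c) (f i) then ∏ i, a (f i) else 0) ≤
      ∑ x, a x * κ x ^ (Fintype.card ι - 1) := by
  have h₁ : ∀ f : ι → R, (if ∀ i, i ≠ c → r (f c) (f i) then ∏ i, a (f i) else 0) =
      a (f c) * ∏ i : {i // i ≠ c}, if r (f c) (f i) then a (f i) else 0 := by
    intro f
    rw [Fintype.prod_eq_mul_prod_subtype_ne _ c, Finset.prod_ite_zero]
    simp
  have h₂ : ∑ f : ι → R, (if ∀ i, i ≠ c → r (f c) (f i) then ∏ i, a (f i) else 0) =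
      ∑ x, a x * ∑ g : {i // i ≠ c} → R, ∏ i, if r x (g i) then a (g i) else 0 := by
    simp only [h₁, mul_sum]
    rw [← Fintype.sum_prod_type']
    exact Fintype.sum_equiv (Equiv.funSplitAt c R) _ _ fun f => rfl
  rw [h₂]
  refine sum_le_sum fun x _ => mul_le_mul_of_nonneg_left ?_ (ha x)
  have h₃ := Finset.prod_univ_sum (fun _ : {i // i ≠ c} => (univ : Finset R))
    (fun _ y => if r x y then a y else 0)
  rw [Fintype.piFinset_univ] at h₃
  rw [← h₃, prod_const, card_univ, Fintype.card_subtype_compl, Fintype.card_subtype_eq,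
    ← sum_filter]
  exact pow_le_pow_left₀ (sum_nonneg fun y _ => ha y) (hκ x) _

open Classical in
-- Union bound over the star through the index 0: b is the number of its other members, chosen among
-- m indices, and b + 1 counts the possible centres. What is left is again a family without isolated
-- members. The case b = 0 drops out because the star is never a single vertex.
theorem noIsolatedWeight_succ_le {a : R → ℝ} (ha : ∀ x, 0 ≤ a x) (r : R → R → Prop)
    (hr : ∀ x y, r x y → r y x) (κ : R → ℝ) (hκ : ∀ x, ∑ y ∈ univ.filter (r x), a y ≤ κ x)
    (m : ℕ) :
    noIsolatedWeight a r (Fin (m + 1)) ≤ ∑ b ∈ range (m + 1), (m.choose b : ℝ) *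
      ((if b = 0 then 0 else ((b : ℝ) + 1) * ∑ x, a x * κ x ^ b) *
        noIsolatedWeight a r (Fin (m - b))) := by
  let star : Finset (Fin (m + 1)) → Fin (m + 1) → (Fin (m + 1) → R) → Prop :=
    fun B c f => ∀ i ∈ B, i ≠ c → r (f c) (f i)
  let rest : Finset (Fin (m + 1)) → (Fin (m + 1) → R) → Prop := fun B f =>
    NoIsolated r fun i : {i // ¬i ∈ B} => f i
  let G : ℕ → ℝ := fun b => (if b = 0 then 0 else ((b : ℝ) + 1) * ∑ x, a x * κ x ^ b) *
        noIsolatedWeight a r (Fin (m - b))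
  let 𝒮 : Finset (Finset (Fin (m + 1))) := (univ.erase 0).powerset
  have hcover : ∀ f : Fin (m + 1) → R, (if NoIsolated r f then ∏ i, a (f i) else 0) ≤
      ∑ S ∈ 𝒮, if S = ∅ then 0 else ∑ c ∈ insert 0 S,
        if star (insert 0 S) c f ∧ rest (insert 0 S) f then ∏ i, a (f i) else 0 := by
    intro f
    have hp : 0 ≤ ∏ i, a (f i) := prod_nonneg fun i _ => ha _
    have hnn : ∀ S : Finset (Fin (m + 1)), 0 ≤ (if S = ∅ then 0 else ∑ c ∈ insert 0 S,
        if star (insert 0 S) c f ∧ rest (insert 0 S) f then ∏ i, a (f i) else 0) := fun S => by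
      split_ifs
      · exact le_rfl
      · exact sum_nonneg fun c _ => by split_ifs <;> simp [hp]
    split_ifs with hf
    · obtain ⟨B, hvB, hB, ⟨c, hc, hstar⟩, hrest⟩ :=
        exists_star (fun i j => r (f i) (f j)) (fun _ _ h => hr _ _ h) hf 0
      have hins : insert 0 (B.erase 0) = B := insert_erase hvB
      have hmem : B.erase 0 ∈ 𝒮 := mem_powerset.mpr (erase_subset_erase _ (subset_univ _))
      refine le_trans ?_ (single_le_sum (fun S _ => hnn S) hmem)
      have hne : B.erase 0 ≠ ∅ := fun h0 => hB (by rw [← hins, h0]; rfl)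
      rw [if_neg hne, hins]
      refine le_trans ?_ (single_le_sum (fun c _ => by split_ifs <;> simp [hp]) hc)
      have hr' : rest B f := by
        rintro ⟨i, hi⟩
        obtain ⟨j, hj, hji, hij⟩ := hrest i hi
        exact ⟨⟨j, hj⟩, fun h => hji (congrArg Subtype.val h), hij⟩
      rw [if_pos ⟨hstar, hr'⟩]
    · exact sum_nonneg fun S _ => hnn S
  have hfac : ∀ B : Finset (Fin (m + 1)), ∀ c ∈ B,
      ∑ f : Fin (m + 1) → R, (if star B c f ∧ rest B f then ∏ i, a (f i) else 0) ≤
        (∑ x, a x * κ x ^ (B.card - 1)) * noIsolatedWeight a r (Fin (m + 1 - B.card)) := by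
    intro B c hc
    have h₁ := sum_restrict_mul_restrict (R := R) (fun i => i ∈ B)
      (fun g => if ∀ i, i ≠ (⟨c, hc⟩ : {i // i ∈ B}) → r (g ⟨c, hc⟩) (g i) then ∏ i, a (g i) else 0)
      (fun g => if NoIsolated r g then ∏ i, a (g i) else 0)
    have h₂ : ∀ f : Fin (m + 1) → R, (if star B c f ∧ rest B f then ∏ i, a (f i) else 0) =
        (if ∀ i : {i // i ∈ B}, i ≠ ⟨c, hc⟩ → r (f c) (f i) then ∏ i : {i // i ∈ B}, a (f i)
          else 0) * (if NoIsolated r (fun i : {i // ¬i ∈ B} => f i)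
            then ∏ i : {i // ¬i ∈ B}, a (f i) else 0) := by
      intro f
      have hs : star B c f ↔ ∀ i : {i // i ∈ B}, i ≠ ⟨c, hc⟩ → r (f c) (f i) := by
        constructor
        · intro h i hi
          exact h i i.2 fun h' => hi (Subtype.ext h')
        · intro h i hi hic
          exact h ⟨i, hi⟩ fun h' => hic (congrArg Subtype.val h')
      rw [← Fintype.prod_subtype_mul_prod_subtype (fun i => i ∈ B) (fun i => a (f i)), ite_and]
      simp only [← hs]
      by_cases h1 : star B c f
      · by_cases h2 : rest B f
        · rw [if_pos h1, if_pos h2, if_pos h1, if_pos h2]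
          congr!
        · rw [if_pos h1, if_neg h2, if_neg h2, mul_zero]
      · rw [if_neg h1, if_neg h1, zero_mul]
    have h₃ := sum_star_weight_le ha r (⟨c, hc⟩ : {i // i ∈ B}) κ hκ
    rw [Fintype.card_coe] at h₃
    have h₄ : noIsolatedWeight a r {i // ¬i ∈ B} =
        noIsolatedWeight a r (Fin (m + 1 - B.card)) := by
      refine noIsolatedWeight_congr a r (Fintype.equivFinOfCardEq ?_)
      rw [Fintype.card_subtype_compl, Fintype.card_fin, Fintype.card_coe]
    rw [sum_congr rfl fun f _ => h₂ f, h₁]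
    rw [← h₄]
    refine le_of_eq_of_le ?_ (mul_le_mul_of_nonneg_right h₃ (noIsolatedWeight_nonneg ha r _))
    rw [noIsolatedWeight]
    congr!
  calc noIsolatedWeight a r (Fin (m + 1))
      ≤ ∑ f : Fin (m + 1) → R, ∑ S ∈ 𝒮, if S = ∅ then 0 else ∑ c ∈ insert 0 S,
        if star (insert 0 S) c f ∧ rest (insert 0 S) f then ∏ i, a (f i) else 0 :=
        le_of_eq_of_le (by rw [noIsolatedWeight]; congr!) (sum_le_sum fun f _ => hcover f)
    _ = ∑ S ∈ 𝒮, if S = ∅ then 0 else ∑ c ∈ insert 0 S, ∑ f : Fin (m + 1) → R,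
        if star (insert 0 S) c f ∧ rest (insert 0 S) f then ∏ i, a (f i) else 0 := by
        rw [sum_comm]
        refine sum_congr rfl fun S _ => ?_
        split_ifs
        · simp
        · rw [sum_comm]
    _ ≤ ∑ S ∈ 𝒮, G S.card := by
        refine sum_le_sum fun S hS => ?_
        have h0 : (0 : Fin (m + 1)) ∉ S := fun h => by
          have := mem_powerset.mp hS h
          simp at this
        have hcard : (insert 0 S).card = S.card + 1 := card_insert_of_notMem h0
        split_ifs with hSe
        · simp [G, hSe]
        · have hSc : S.card ≠ 0 := by rwa [Ne, card_eq_zero]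
          refine (sum_le_sum fun c hc => hfac _ c hc).trans (le_of_eq ?_)
          rw [sum_const, hcard, nsmul_eq_mul]
          simp only [G, if_neg hSc, Nat.add_sub_cancel]
          rw [Nat.add_sub_add_right]
          push_cast; ring
    _ = _ := by
        rw [sum_powerset_apply_card G, card_erase_of_mem (mem_univ _), card_univ, Fintype.card_fin,
          Nat.add_sub_cancel]
        exact sum_congr rfl fun b _ => nsmul_eq_mul _ _

/-- Exponential bound for the exponential generating function of a sequence with
`N (m + 1) ≤ ∑ b, choose m b * w b * N (m - b)`, where `w b ≤ K (b + 1) z ^ b`. -/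
theorem sum_div_factorial_le_exp (N w : ℕ → ℝ) (K z : ℝ) (hK : 0 ≤ K) (hz : 0 ≤ z)
    (hN : ∀ m, 0 ≤ N m) (hN0 : N 0 ≤ 1) (hw0 : w 0 = 0)
    (hw : ∀ b, w b ≤ K * ((b + 1) * z ^ b)) (hwnn : ∀ b, 0 ≤ w b)
    (hrec : ∀ m, N (m + 1) ≤ ∑ b ∈ range (m + 1), (m.choose b : ℝ) * (w b * N (m - b)))
    {t : ℝ} (ht : 0 ≤ t) (M : ℕ) :
    ∑ m ∈ range M, t ^ m / (m.factorial : ℝ) * N m ≤ Real.exp (K * t * (Real.exp (z * t) - 1)) := by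
  -- The series of (b + 1) x^b / b! sums to (1 + x) e^x; the −1 is the missing term b = 0. The
  -- result is the derivative of K s (e^{zs} − 1).
  have hwsum : ∀ M : ℕ, ∀ s : ℝ, 0 ≤ s → ∑ b ∈ range M, s ^ b / (b.factorial : ℝ) * w b ≤
      K * (Real.exp (z * s) * (1 + z * s) - 1) := by
    intro M s hs
    have hzs : 0 ≤ z * s := mul_nonneg hz hs
    have hg : ∑ b ∈ range (M + 1), s ^ b / (b.factorial : ℝ) * w b ≤
        K * (∑ b ∈ range (M + 1), (b + 1) * ((z * s) ^ b / (b.factorial : ℝ)) - 1) := by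
      rw [sum_range_succ', sum_range_succ' (fun b : ℕ => ((b : ℝ) + 1) * _), hw0]
      simp only [mul_zero, add_zero, pow_zero, Nat.factorial_zero, Nat.cast_one, div_one,
        Nat.cast_zero, zero_add, mul_one, add_sub_cancel_right]
      rw [mul_sum]
      refine sum_le_sum fun b _ => ?_
      refine (mul_le_mul_of_nonneg_left (hw (b + 1)) (by positivity)).trans (le_of_eq ?_)
      rw [mul_pow]; push_cast; ring
    have h₁ : ∑ b ∈ range (M + 1), ((b : ℝ) + 1) * ((z * s) ^ b / (b.factorial : ℝ)) ≤
        Real.exp (z * s) * (1 + z * s) := by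
      simp only [add_mul, one_mul, sum_add_distrib]
      rw [sum_range_succ' (fun b : ℕ => (b : ℝ) * _)]
      have h₂ : ∀ b ∈ range M, (((b + 1 : ℕ) : ℝ)) * ((z * s) ^ (b + 1) / ((b + 1).factorial : ℝ)) =
          z * s * ((z * s) ^ b / (b.factorial : ℝ)) := fun b _ => by
        rw [Nat.factorial_succ]; push_cast
        have : ((b : ℝ) + 1) ≠ 0 := by positivity
        field_simp
        ring
      rw [sum_congr rfl h₂, ← mul_sum]
      have h₃ := Real.sum_le_exp_of_nonneg hzs M
      have h₄ := Real.sum_le_exp_of_nonneg hzs (M + 1)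
      have := mul_le_mul_of_nonneg_left h₃ hzs
      push_cast
      linarith
    calc _ ≤ ∑ b ∈ range (M + 1), s ^ b / (b.factorial : ℝ) * w b := by
          rw [sum_range_succ]
          exact le_add_of_nonneg_right (mul_nonneg (by positivity) (hwnn _))
      _ ≤ _ := hg.trans (mul_le_mul_of_nonneg_left (by linarith) hK)
  let P : ℕ → ℝ → ℝ := fun M s => ∑ m ∈ range M, s ^ m / (m.factorial : ℝ) * N m
  have hPnn : ∀ M s, 0 ≤ s → 0 ≤ P M s := fun M s hs =>
    sum_nonneg fun m _ => mul_nonneg (by positivity) (hN m)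
  have hPmono : ∀ M s, 0 ≤ s → P M s ≤ P (M + 1) s := fun M s hs => by
    simp only [P, sum_range_succ]
    exact le_add_of_nonneg_right (mul_nonneg (by positivity) (hN _))
  have hderiv : ∀ M s, HasDerivAt (P (M + 1))
      (∑ m ∈ range M, s ^ m / (m.factorial : ℝ) * N (m + 1)) s := by
    intro M s
    have h := HasDerivAt.fun_sum (u := range (M + 1)) (x := s) fun m _ =>
      ((hasDerivAt_pow m s).div_const (m.factorial : ℝ)).mul_const (N m)
    refine h.congr_deriv ?_
    rw [sum_range_succ']
    simp only [Nat.cast_zero, zero_mul, zero_div, add_zero, Nat.add_sub_cancel]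
    refine sum_congr rfl fun m _ => ?_
    rw [Nat.factorial_succ]; push_cast
    have : ((m : ℝ) + 1) ≠ 0 := by positivity
    field_simp
  -- The binomial recursion is a Cauchy product of exponential generating functions. The truncated
  -- product is dominated by the product of truncations, so the differential inequality already
  -- holds for partial sums and convergence need not be known.
  have hbound : ∀ M s, 0 ≤ s → ∑ m ∈ range M, s ^ m / (m.factorial : ℝ) * N (m + 1) ≤
      K * (Real.exp (z * s) * (1 + z * s) - 1) * P (M + 1) s := by
    intro M s hs
    calc _ ≤ ∑ m ∈ range M, ∑ b ∈ range (m + 1), (s ^ b / (b.factorial : ℝ) * w b) *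
          (s ^ (m - b) / ((m - b).factorial : ℝ) * N (m - b)) := by
          refine sum_le_sum fun m _ => ?_
          refine (mul_le_mul_of_nonneg_left (hrec m) (by positivity)).trans (le_of_eq ?_)
          rw [mul_sum]
          refine sum_congr rfl fun b hb => ?_
          have hbm : b ≤ m := Nat.lt_succ_iff.mp (mem_range.mp hb)
          rw [Nat.cast_choose ℝ hbm]
          have hsp : s ^ m = s ^ b * s ^ (m - b) := by rw [← pow_add, Nat.add_sub_cancel' hbm]
          rw [hsp]
          have := Nat.factorial_ne_zero m
          field_simp
      _ = ∑ b ∈ range M, ∑ j ∈ range (M - b), (s ^ b / (b.factorial : ℝ) * w b) *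
          (s ^ j / (j.factorial : ℝ) * N j) :=
          sum_range_diag_flip M fun b j => (s ^ b / (b.factorial : ℝ) * w b) *
            (s ^ j / (j.factorial : ℝ) * N j)
      _ ≤ ∑ b ∈ range M, (s ^ b / (b.factorial : ℝ) * w b) * P (M + 1) s := by
          refine sum_le_sum fun b _ => ?_
          rw [← mul_sum]
          refine mul_le_mul_of_nonneg_left ?_ (mul_nonneg (by positivity) (hwnn b))
          exact sum_le_sum_of_subset_of_nonneg (range_mono (by omega))
            fun j _ _ => mul_nonneg (by positivity) (hN j)
      _ ≤ _ := by
          rw [← sum_mul]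
          exact mul_le_mul_of_nonneg_right (hwsum M s hs) (hPnn _ s hs)
  refine (hPmono M t ht).trans ?_
  -- Grönwall's argument: with this integrating factor the differential inequality says that `h`
  -- decreases from `N 0`.
  let h : ℝ → ℝ := fun s => P (M + 1) s * Real.exp (-(K * s * (Real.exp (z * s) - 1)))
  have hh : ∀ s, HasDerivAt h ((∑ m ∈ range M, s ^ m / (m.factorial : ℝ) * N (m + 1) -
      K * (Real.exp (z * s) * (1 + z * s) - 1) * P (M + 1) s) *
        Real.exp (-(K * s * (Real.exp (z * s) - 1)))) s := by
    intro s
    have h₁ : HasDerivAt (fun s => Real.exp (z * s)) (Real.exp (z * s) * z) s := by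
      simpa using ((hasDerivAt_id s).const_mul z).exp
    have h₂ := ((((hasDerivAt_id s).const_mul K).mul (h₁.sub_const 1)).neg).exp
    refine ((hderiv M s).mul h₂).congr_deriv ?_
    simp only [id, Pi.mul_apply, Pi.neg_apply, mul_one]
    ring
  have hanti : AntitoneOn h (Set.Ici 0) := by
    refine antitoneOn_of_deriv_nonpos (convex_Ici 0)
      (fun s _ => (hh s).continuousAt.continuousWithinAt)
      (fun s _ => (hh s).differentiableAt.differentiableWithinAt) fun s hs => ?_
    rw [interior_Ici] at hs
    rw [(hh s).deriv]
    exact mul_nonpos_of_nonpos_of_nonneg (sub_nonpos.mpr (hbound M s (le_of_lt hs)))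
      (Real.exp_nonneg _)
  have h1 := hanti (Set.mem_Ici.mpr le_rfl) (Set.mem_Ici.mpr ht) ht
  have h0 : h 0 = N 0 := by
    simp only [h, P, sum_range_succ']
    simp
  rw [h0] at h1
  have h2 : P (M + 1) t * Real.exp (-(K * t * (Real.exp (z * t) - 1))) ≤ 1 := h1.trans hN0
  rwa [Real.exp_neg, ← div_eq_mul_inv, div_le_one (Real.exp_pos _)] at h2

end StarForests

/-! ### Local operators, decay of correlations and the moment generating function. -/

section Locality

open Matrix
open scoped Matrix.Norms.L2Operator Kronecker

namespace SpinSystem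

variable {V : Type*} [Fintype V] [DecidableEq V] {q : ℕ}

/-- Splitting configurations into their restrictions to Λ and to its complement makes B ⊗ 1 a
literal Kronecker product, from which products and adjoints are inherited. -/
theorem embed_eq_submatrix (Λ : Finset V) (B : Op Λ q) :
    embed Λ B = (B ⊗ₖ (1 : Matrix ({v // ¬v ∈ Λ} → Fin q) ({v // ¬v ∈ Λ} → Fin q) ℂ)).submatrix
      (Equiv.piEquivPiSubtypeProd (· ∈ Λ) fun _ => Fin q)
      (Equiv.piEquivPiSubtypeProd (· ∈ Λ) fun _ => Fin q) := by
  ext u v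
  simp only [embed, of_apply, submatrix_apply, kroneckerMap_apply, one_apply,
    Equiv.piEquivPiSubtypeProd_apply, funext_iff, Subtype.forall, mul_ite, mul_one, mul_zero]

theorem embed_mul (Λ : Finset V) (B B' : Op Λ q) :
    embed Λ B * embed Λ B' = embed Λ (B * B') := by
  rw [embed_eq_submatrix, embed_eq_submatrix, embed_eq_submatrix, submatrix_mul_equiv,
    ← mul_kronecker_mul, mul_one]

theorem embed_one (Λ : Finset V) : embed Λ (1 : Op Λ q) = 1 := by
  rw [embed_eq_submatrix, one_kronecker_one, submatrix_one_equiv]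

theorem embed_smul (Λ : Finset V) (c : ℂ) (B : Op Λ q) : embed Λ (c • B) = c • embed Λ B := by
  ext u v
  simp [embed]

theorem embed_sub (Λ : Finset V) (B B' : Op Λ q) : embed Λ (B - B') = embed Λ B - embed Λ B' := by
  ext u v
  simp only [embed, of_apply, Matrix.sub_apply]
  split_ifs <;> simp

theorem embed_add (Λ : Finset V) (B B' : Op Λ q) : embed Λ (B + B') = embed Λ B + embed Λ B' := by
  ext u v
  simp only [embed, of_apply, Matrix.add_apply]
  split_ifs <;> simp

theorem embed_conjTranspose (Λ : Finset V) (B : Op Λ q) : (embed Λ B)ᴴ = embed Λ Bᴴ := by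
  rw [embed_eq_submatrix, embed_eq_submatrix, conjTranspose_submatrix, conjTranspose_kronecker,
    conjTranspose_one]

namespace ActsOn

variable {Λ Λ' : Finset V} {X Y : Op V q}

theorem mul (hX : ActsOn Λ X) (hY : ActsOn Λ Y) : ActsOn Λ (X * Y) := by
  obtain ⟨B, rfl⟩ := hX
  obtain ⟨B', rfl⟩ := hY
  exact ⟨B * B', embed_mul Λ B B'⟩

theorem one : ActsOn Λ (1 : Op V q) := ⟨1, (embed_one Λ).symm⟩

theorem smul (c : ℂ) (hX : ActsOn Λ X) : ActsOn Λ (c • X) := by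
  obtain ⟨B, rfl⟩ := hX
  exact ⟨c • B, (embed_smul Λ c B).symm⟩

theorem zero : ActsOn Λ (0 : Op V q) := by simpa using (one (Λ := Λ) (q := q)).smul 0

theorem sub (hX : ActsOn Λ X) (hY : ActsOn Λ Y) : ActsOn Λ (X - Y) := by
  obtain ⟨B, rfl⟩ := hX
  obtain ⟨B', rfl⟩ := hY
  exact ⟨B - B', (embed_sub Λ B B').symm⟩

theorem add (hX : ActsOn Λ X) (hY : ActsOn Λ Y) : ActsOn Λ (X + Y) := by
  obtain ⟨B, rfl⟩ := hX
  obtain ⟨B', rfl⟩ := hY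
  exact ⟨B + B', (embed_add Λ B B').symm⟩

theorem conjTranspose (hX : ActsOn Λ X) : ActsOn Λ Xᴴ := by
  obtain ⟨B, rfl⟩ := hX
  exact ⟨Bᴴ, embed_conjTranspose Λ B⟩

theorem mono (hX : ActsOn Λ X) (h : Λ ⊆ Λ') : ActsOn Λ' X := by
  obtain ⟨B, rfl⟩ := hX
  refine ⟨Matrix.of fun a b => if ∀ v : Λ', (v : V) ∉ Λ → a v = b v then
    B (fun v => a ⟨v, h v.2⟩) (fun v => b ⟨v, h v.2⟩) else 0, ?_⟩
  ext u v
  simp only [embed, of_apply, Subtype.forall]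
  by_cases h1 : ∀ x, x ∉ Λ → u x = v x
  · rw [if_pos h1, if_pos fun x hx => h1 x fun hx' => hx (h hx'), if_pos fun x _ hx => h1 x hx]
  · rw [if_neg h1]
    by_cases h2 : ∀ x, x ∉ Λ' → u x = v x
    · rw [if_pos h2, if_neg]
      intro h3
      refine h1 fun x hx => ?_
      by_cases hx' : x ∈ Λ'
      · exact h3 x hx' hx
      · exact h2 x hx'
    · rw [if_neg h2]

theorem eq_smul_one (hX : ActsOn ∅ X) : ∃ c : ℂ, X = c • 1 := by
  obtain ⟨B, rfl⟩ := hX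
  refine ⟨B (fun x => absurd x.2 (Finset.notMem_empty _)) fun x =>
    absurd x.2 (Finset.notMem_empty _), ?_⟩
  ext u v
  rw [Matrix.smul_apply, one_apply, embed, of_apply]
  by_cases h : u = v
  · rw [if_pos h, if_pos fun x _ => congrFun h x, smul_eq_mul, mul_one]
    congr 1 <;> exact funext fun x => absurd x.2 (Finset.notMem_empty _)
  · rw [if_neg h, if_neg fun h' => h (funext fun x => h' x (Finset.notMem_empty x)), smul_zero]

theorem commute (hX : ActsOn Λ X) (hY : ActsOn Λ' Y) (h : Disjoint Λ Λ') : X * Y = Y * X := by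
  obtain ⟨B, rfl⟩ := hX
  obtain ⟨B', rfl⟩ := hY
  have hd : ∀ x, x ∈ Λ → x ∉ Λ' := fun x hx => Finset.disjoint_left.mp h hx
  ext u w
  -- In each of the two products a single intermediate configuration contributes: the first factor
  -- can change only its own region, and the second must do the remaining changes.
  let v₀ : V → Fin q := fun x => if x ∈ Λ then w x else u x
  let v₁ : V → Fin q := fun x => if x ∈ Λ then u x else w x
  have h₀ : (embed Λ B * embed Λ' B') u w = embed Λ B u v₀ * embed Λ' B' v₀ w := by
    rw [mul_apply]
    refine Finset.sum_eq_single v₀ (fun v _ hv => ?_) fun h => absurd (Finset.mem_univ _) h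
    obtain ⟨x, hx⟩ := Function.ne_iff.mp hv
    simp only [embed, of_apply]
    by_cases hxΛ : x ∈ Λ
    · rw [if_neg (c := ∀ v_1, v_1 ∉ Λ' → v v_1 = w v_1), mul_zero]
      intro h'
      exact hx (by simpa [v₀, hxΛ] using h' x (hd x hxΛ))
    · rw [if_neg, zero_mul]
      intro h'
      exact hx (by simpa [v₀, hxΛ] using (h' x hxΛ).symm)
  have h₁ : (embed Λ' B' * embed Λ B) u w = embed Λ' B' u v₁ * embed Λ B v₁ w := by
    rw [mul_apply]
    refine Finset.sum_eq_single v₁ (fun v _ hv => ?_) fun h => absurd (Finset.mem_univ _) h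
    obtain ⟨x, hx⟩ := Function.ne_iff.mp hv
    simp only [embed, of_apply]
    by_cases hxΛ : x ∈ Λ
    · rw [if_neg, zero_mul]
      intro h'
      exact hx (by simpa [v₁, hxΛ] using (h' x (hd x hxΛ)).symm)
    · rw [if_neg (c := ∀ v_1, v_1 ∉ Λ → v v_1 = w v_1), mul_zero]
      intro h'
      exact hx (by simpa [v₁, hxΛ] using h' x hxΛ)
  have e₁ : embed Λ B u v₀ = embed Λ B v₁ w := by
    simp only [embed, of_apply]
    rw [if_pos fun x hx => by simp [v₀, hx], if_pos fun x hx => by simp [v₁, hx]]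
    congr 1 <;> funext x
    · simp [v₁]
    · simp [v₀]
  have e₂ : embed Λ' B' v₀ w = embed Λ' B' u v₁ := by
    have hx' : ∀ x : Λ', (x : V) ∉ Λ := fun x hx => hd x hx x.2
    have hb₀ : (fun x : Λ' => v₀ x) = fun x : Λ' => u x := funext fun x => by simp [v₀, hx' x]
    have hb₁ : (fun x : Λ' => v₁ x) = fun x : Λ' => w x := funext fun x => by simp [v₁, hx' x]
    have hc : (∀ x, x ∉ Λ' → v₀ x = w x) ↔ ∀ x, x ∉ Λ' → u x = v₁ x := by
      refine forall_congr' fun x => forall_congr' fun _ => ?_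
      by_cases hx : x ∈ Λ <;> simp [v₀, v₁, hx]
    simp only [embed, of_apply, hb₀, hb₁, hc]
  rw [h₀, h₁, e₁, e₂, mul_comm]

theorem list_prod {l : List (Op V q)} (h : ∀ Y ∈ l, ActsOn Λ Y) : ActsOn Λ l.prod := by
  induction l with
  | nil => exact one
  | cons Y l ih =>
    rw [List.prod_cons]
    exact (h Y (by simp)).mul (ih fun Z hZ => h Z (by simp [hZ]))

theorem list_prod_commute {l : List (Op V q)} (hX : ActsOn Λ X) (hl : ∀ Y ∈ l, ActsOn Λ' Y)
    (h : Disjoint Λ Λ') : l.prod * X = X * l.prod :=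
  (hX.commute (list_prod hl) h).symm

end ActsOn

theorem opNorm_nonneg (X : Op V q) : 0 ≤ opNorm X := norm_nonneg _

theorem opNorm_one_le : opNorm (1 : Op V q) ≤ 1 := norm_le_one_of_unitary (by simp)

theorem opNorm_mul_le (X Y : Op V q) : opNorm (X * Y) ≤ opNorm X * opNorm Y :=
  norm_mul_le (α := Matrix (V → Fin q) (V → Fin q) ℂ) X Y

theorem opNorm_list_prod_le {ι : Type*} (h : ι → Op V q) (a : ι → ℝ) (hh : ∀ i, opNorm (h i) ≤ a i)
    (l : List ι) : opNorm (l.map h).prod ≤ (l.map a).prod := by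
  induction l with
  | nil => simpa using opNorm_one_le
  | cons i l ih =>
    rw [List.map_cons, List.prod_cons, List.map_cons, List.prod_cons]
    exact (opNorm_mul_le _ _).trans (mul_le_mul (hh i) ih (opNorm_nonneg _)
      ((opNorm_nonneg _).trans (hh i)))

/-- Two regions are related if they have a pair of spins at distance at most `r`. -/
def Near [MetricSpace V] (r : ℝ) (Λ Λ' : Finset V) : Prop := ∃ x ∈ Λ, ∃ y ∈ Λ', dist x y ≤ r

omit [Fintype V] [DecidableEq V] in
theorem Near.symm [MetricSpace V] {r : ℝ} {Λ Λ' : Finset V} (h : Near r Λ Λ') : Near r Λ' Λ := by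
  obtain ⟨x, hx, y, hy, hxy⟩ := h
  exact ⟨y, hy, x, hx, by rwa [dist_comm]⟩

/-- The self-adjoint part of an operator. -/
noncomputable def hermitianPart (P : Op V q) : Op V q := (2⁻¹ : ℂ) • (P + Pᴴ)

theorem isObservableOn_hermitianPart {S : Finset V} {P : Op V q} (hP : ActsOn S P) :
    IsObservableOn S (hermitianPart P) := by
  refine ⟨?_, (hP.add hP.conjTranspose).smul _⟩
  rw [IsHermitian, hermitianPart, conjTranspose_smul, conjTranspose_add,
    conjTranspose_conjTranspose, add_comm]
  simp

theorem opNorm_hermitianPart_le (P : Op V q) : opNorm (hermitianPart P) ≤ opNorm P := by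
  rw [opNorm_eq_norm, opNorm_eq_norm, hermitianPart]
  have h1 : ‖P + Pᴴ‖ ≤ ‖P‖ + ‖P‖ := (norm_add_le _ _).trans_eq (by rw [l2_opNorm_conjTranspose])
  have h2 : ‖(2⁻¹ : ℂ) • (P + Pᴴ)‖ ≤ ‖(2⁻¹ : ℂ)‖ * ‖P + Pᴴ‖ := norm_smul_le _ _
  have h3 : ‖(2⁻¹ : ℂ)‖ = 2⁻¹ := by norm_num
  rw [h3] at h2
  linarith

/-- The correlations of an observable with a (not self-adjoint) operator of a distant region. -/
theorem HasCorrelationLength.re_trace_le [MetricSpace V] {C ξ r : ℝ} {ω h P : Op V q}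
    (hω : IsState ω) (hC : 0 ≤ C) (hξ : 0 < ξ) (hcorr : HasCorrelationLength C ξ ω)
    {Λ S : Finset V} (hh : IsObservableOn Λ h) (hP : ActsOn S P) (h0 : (ω * h).trace = 0)
    (hΛ : Λ.Nonempty) (hr : 0 ≤ r) (hfar : ¬Near r Λ S) :
    (ω * (h * P)).trace.re ≤ C * opNorm h * opNorm P * Real.exp (-r / ξ) := by
  have hrhs : 0 ≤ C * opNorm h * opNorm P * Real.exp (-r / ξ) :=
    mul_nonneg (mul_nonneg (mul_nonneg hC (opNorm_nonneg _)) (opNorm_nonneg _)) (Real.exp_nonneg _)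
  -- For S empty `regionDist` is the infimum of the empty set, that is 0, and the hypothesis gives
  -- no decay; but then P is a scalar and h is centred.
  rcases S.eq_empty_or_nonempty with rfl | hS
  · obtain ⟨c, rfl⟩ := hP.eq_smul_one
    rw [Matrix.mul_smul, mul_one, Matrix.mul_smul, trace_smul, h0]
    simpa using hrhs
  have hdist : ∀ x ∈ Λ, ∀ y ∈ S, r < dist x y := fun x hx y hy => by
    by_contra hle
    exact hfar ⟨x, hx, y, hy, not_lt.mp hle⟩
  have hdisj : Disjoint Λ S := Finset.disjoint_left.mpr fun x hx hx' => by
    have := hdist x hx x hx'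
    rw [dist_self] at this
    exact absurd this (not_lt.mpr hr)
  have hreg : r ≤ regionDist Λ S := by
    obtain ⟨x, hx⟩ := hΛ
    obtain ⟨y, hy⟩ := hS
    refine le_csInf ⟨_, x, hx, y, hy, rfl⟩ ?_
    rintro _ ⟨x, hx, y, hy, rfl⟩
    exact (hdist x hx y hy).le
  let Q : Op V q := hermitianPart P
  have hQ : IsObservableOn S Q := isObservableOn_hermitianPart hP
  have hQn : opNorm Q ≤ opNorm P := opNorm_hermitianPart_le P
  -- The correlation hypothesis concerns self-adjoint operators only. Since h commutes with P*, the
  -- real part sees only the self-adjoint part of P.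
  have hre : (ω * (h * P)).trace.re = (ω * (h * Q)).trace.re := by
    have h1 : (ω * (h * Pᴴ)).trace = star (ω * (h * P)).trace := by
      rw [← trace_conjTranspose, conjTranspose_mul, conjTranspose_mul, hω.1.1.eq, hh.1.eq,
        hh.2.commute hP.conjTranspose hdisj, trace_mul_comm]
    have h2 : (ω * (h * Q)).trace = 2⁻¹ * ((ω * (h * P)).trace + star (ω * (h * P)).trace) := by
      rw [← h1]
      simp only [Q, hermitianPart, Matrix.mul_smul, mul_add, trace_smul, trace_add, smul_eq_mul]
    rw [h2, RCLike.star_def, Complex.add_conj, ← Complex.ofReal_ofNat, ← Complex.ofReal_inv,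
      ← Complex.ofReal_mul, Complex.ofReal_re]
    ring
  have hb := hcorr Λ S h Q hdisj hh hQ
  rw [h0, zero_mul, sub_zero] at hb
  rw [hre]
  refine (Complex.re_le_norm _).trans (hb.trans ?_)
  exact mul_le_mul
    (mul_le_mul_of_nonneg_left hQn (mul_nonneg hC (opNorm_nonneg _)))
    (Real.exp_le_exp.mpr (div_le_div_of_nonneg_right (neg_le_neg hreg) hξ.le))
    (Real.exp_nonneg _) (mul_nonneg (mul_nonneg hC (opNorm_nonneg _)) (opNorm_nonneg _))

/-- A region far from all the others is disjoint from them, so its term can be commuted to the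
front; the other factors merge into one operator on the union of their regions. -/
theorem re_trace_list_prod_le [MetricSpace V] {C ξ r : ℝ} {ω : Op V q}
    (hω : IsState ω) (hC : 0 ≤ C) (hξ : 0 < ξ) (hcorr : HasCorrelationLength C ξ ω) (hr : 0 ≤ r)
    {h : Finset V → Op V q} {a : Finset V → ℝ} (hobs : ∀ Λ, IsObservableOn Λ (h Λ))
    (ha : ∀ Λ, opNorm (h Λ) ≤ a Λ) (h0 : ∀ Λ, (ω * h Λ).trace = 0)
    (l₁ l₂ : List (Finset V)) {Λ : Finset V} (hΛ : Λ.Nonempty)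
    (hfar : ∀ Λ' ∈ l₁ ++ l₂, ¬Near r Λ Λ') :
    (ω * ((l₁ ++ Λ :: l₂).map h).prod).trace.re ≤
      C * Real.exp (-r / ξ) * ((l₁ ++ Λ :: l₂).map a).prod := by
  let S : Finset V := Finset.univ.filter fun x => ∃ Λ' ∈ l₁ ++ l₂, x ∈ Λ'
  have hsub : ∀ Λ' ∈ l₁ ++ l₂, ActsOn S (h Λ') := fun Λ' hΛ' =>
    (hobs Λ').2.mono fun x hx => by simpa [S] using ⟨Λ', by simpa using hΛ', hx⟩
  have hnear : ¬Near r Λ S := by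
    rintro ⟨x, hx, y, hy, hxy⟩
    obtain ⟨Λ', hΛ', hy'⟩ := (Finset.mem_filter.mp hy).2
    exact hfar Λ' hΛ' ⟨x, hx, y, hy', hxy⟩
  have hdisj : Disjoint Λ S := Finset.disjoint_left.mpr fun x hx hx' =>
    hnear ⟨x, hx, x, hx', by rwa [dist_self]⟩
  have h₁ : ∀ Y ∈ l₁.map h, ActsOn S Y := fun Y hY => by
    obtain ⟨Λ', hΛ', rfl⟩ := List.mem_map.mp hY
    exact hsub Λ' (List.mem_append_left _ hΛ')
  have h₂ : ∀ Y ∈ l₂.map h, ActsOn S Y := fun Y hY => by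
    obtain ⟨Λ', hΛ', rfl⟩ := List.mem_map.mp hY
    exact hsub Λ' (List.mem_append_right _ hΛ')
  have hprod : ((l₁ ++ Λ :: l₂).map h).prod = h Λ * ((l₁ ++ l₂).map h).prod := by
    rw [List.map_append, List.prod_append, List.map_cons, List.prod_cons, ← mul_assoc,
      ActsOn.list_prod_commute (hobs Λ).2 h₁ hdisj, mul_assoc, ← List.prod_append, List.map_append]
  have hprod' : ((l₁ ++ Λ :: l₂).map a).prod = a Λ * ((l₁ ++ l₂).map a).prod := by
    simp only [List.map_append, List.prod_append, List.map_cons, List.prod_cons]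
    ring
  have hP : ActsOn S ((l₁ ++ l₂).map h).prod := by
    rw [List.map_append, List.prod_append]
    exact (ActsOn.list_prod h₁).mul (ActsOn.list_prod h₂)
  rw [hprod, hprod']
  refine (hcorr.re_trace_le hω hC hξ (hobs Λ) hP (h0 Λ) hΛ hr hnear).trans ?_
  have hn := opNorm_list_prod_le h a ha (l₁ ++ l₂)
  have h1 := mul_le_mul (ha Λ) hn (opNorm_nonneg _) ((opNorm_nonneg _).trans (ha Λ))
  calc _ = C * Real.exp (-r / ξ) * (opNorm (h Λ) * opNorm ((l₁ ++ l₂).map h).prod) := by ring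
    _ ≤ _ := mul_le_mul_of_nonneg_left h1 (by positivity)

open Classical in
theorem re_trace_ofFn_prod_le [MetricSpace V] {C ξ r : ℝ} {ω : Op V q}
    (hω : IsState ω) (hC : 0 ≤ C) (hξ : 0 < ξ) (hcorr : HasCorrelationLength C ξ ω) (hr : 0 ≤ r)
    {h : Finset V → Op V q} {a : Finset V → ℝ} (hobs : ∀ Λ, IsObservableOn Λ (h Λ))
    (ha : ∀ Λ, opNorm (h Λ) ≤ a Λ) (h0 : ∀ Λ, (ω * h Λ).trace = 0) (hempty : h ∅ = 0)
    {m : ℕ} (g : Fin m → Finset V) :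
    (ω * (List.ofFn fun i => h (g i)).prod).trace.re ≤
      (if NoIsolated (Near r) g then ∏ i, a (g i) else 0) +
        C * Real.exp (-r / ξ) * ∏ i, a (g i) := by
  have hann : ∀ Λ, 0 ≤ a Λ := fun Λ => (opNorm_nonneg _).trans (ha Λ)
  have hpa : 0 ≤ ∏ i, a (g i) := Finset.prod_nonneg fun i _ => hann _
  have hCe : 0 ≤ C * Real.exp (-r / ξ) := by positivity
  have hl : (List.ofFn fun i => h (g i)) = (List.ofFn g).map h := by rw [List.map_ofFn]; rfl
  have hla : ∏ i, a (g i) = ((List.ofFn g).map a).prod := by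
    rw [List.map_ofFn, List.prod_ofFn]; rfl
  rw [hl]
  split_ifs with hg
  · refine le_add_of_le_of_nonneg ?_ (mul_nonneg hCe hpa)
    rw [hla]
    exact (Complex.re_le_norm _).trans ((hω.norm_trace_mul_le _).trans
      (opNorm_list_prod_le h a ha _))
  · rw [zero_add]
    simp only [NoIsolated, not_forall, not_exists, not_and] at hg
    obtain ⟨i, hi⟩ := hg
    have hsplit : List.ofFn g = (List.ofFn g).take i ++ g i :: (List.ofFn g).drop (i + 1) := by
      conv_lhs => rw [← List.take_append_drop (i : ℕ) (List.ofFn g)]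
      congr 1
      rw [List.drop_eq_getElem_cons (by simp)]
      simp
    -- The empty region is near nothing, so it always counts as isolated; the word then vanishes
    -- because `h ∅ = 0`.
    rcases (g i).eq_empty_or_nonempty with he | hne
    · have : ((List.ofFn g).map h).prod = 0 := by
        refine List.prod_eq_zero ?_
        rw [List.mem_map]
        exact ⟨g i, by simp, by rw [he, hempty]⟩
      rw [this, mul_zero, trace_zero]
      simpa using mul_nonneg hCe hpa
    · rw [hla, hsplit]
      refine re_trace_list_prod_le hω hC hξ hcorr hr hobs ha h0 _ _ hne fun Λ' hΛ' => ?_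
      rw [List.mem_append, List.mem_take_iff_getElem, List.mem_drop_iff_getElem] at hΛ'
      rcases hΛ' with ⟨j, hj, rfl⟩ | ⟨j, hj, rfl⟩
      · simp only [List.length_ofFn, lt_inf_iff] at hj
        rw [List.getElem_ofFn]
        exact hi _ fun h' => by
          have := congrArg Fin.val h'
          simp at this
          omega
      · simp only [List.length_ofFn] at hj
        rw [List.getElem_ofFn]
        exact hi _ fun h' => by
          have := congrArg Fin.val h'
          simp at this
          omega

end SpinSystem

theorem sum_pow_eq_sum_ofFn {R S : Type*} [Fintype R] [Semiring S] (h : R → S) (m : ℕ) :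
    (∑ x, h x) ^ m = ∑ g : Fin m → R, (List.ofFn fun i => h (g i)).prod := by
  induction m with
  | zero => simp
  | succ m ih =>
    rw [pow_succ', ih, Finset.sum_mul_sum, ← Fintype.sum_prod_type']
    refine Fintype.sum_equiv (Fin.consEquiv fun _ => R) _ _ fun p => ?_
    simp [Fin.consEquiv, List.ofFn_succ]

namespace SpinSystem

variable {V : Type*} [Fintype V] [DecidableEq V] {q : ℕ}

theorem re_trace_sum_pow_le [MetricSpace V] {C ξ r : ℝ} {ω : Op V q}
    (hω : IsState ω) (hC : 0 ≤ C) (hξ : 0 < ξ) (hcorr : HasCorrelationLength C ξ ω) (hr : 0 ≤ r)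
    {h : Finset V → Op V q} {a : Finset V → ℝ} (hobs : ∀ Λ, IsObservableOn Λ (h Λ))
    (ha : ∀ Λ, opNorm (h Λ) ≤ a Λ) (h0 : ∀ Λ, (ω * h Λ).trace = 0) (hempty : h ∅ = 0) (m : ℕ) :
    (ω * (∑ Λ, h Λ) ^ m).trace.re ≤
      noIsolatedWeight a (Near r) (Fin m) + C * Real.exp (-r / ξ) * (∑ Λ, a Λ) ^ m := by
  classical
  have h₁ : (∑ Λ, a Λ) ^ m = ∑ g : Fin m → Finset V, ∏ i, a (g i) := by
    rw [sum_pow_eq_sum_ofFn]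
    exact Finset.sum_congr rfl fun g _ => List.prod_ofFn
  rw [sum_pow_eq_sum_ofFn, Finset.mul_sum, trace_sum, Complex.re_sum, h₁, Finset.mul_sum,
    noIsolatedWeight]
  refine (Finset.sum_le_sum fun g _ =>
    re_trace_ofFn_prod_le hω hC hξ hcorr hr hobs ha h0 hempty g).trans (le_of_eq ?_)
  rw [Finset.sum_add_distrib]
  congr!

open Classical in
/-- The moment generating function of a sum of centred local observables in a state with
exponentially decaying correlations. -/
theorem re_trace_exp_le [MetricSpace V] {C ξ r : ℝ} {ω : Op V q}
    (hω : IsState ω) (hC : 0 ≤ C) (hξ : 0 < ξ) (hcorr : HasCorrelationLength C ξ ω) (hr : 0 ≤ r)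
    {h : Finset V → Op V q} {a : Finset V → ℝ} (hobs : ∀ Λ, IsObservableOn Λ (h Λ))
    (ha : ∀ Λ, opNorm (h Λ) ≤ a Λ) (h0 : ∀ Λ, (ω * h Λ).trace = 0) (hempty : h ∅ = 0)
    {D ℓ N₁ t : ℝ} (hD : 0 ≤ D) (hℓ : 0 < ℓ) (ht : 0 ≤ t)
    (hsmall : ∀ Λ, a Λ ≠ 0 → (Λ.card : ℝ) ≤ ℓ)
    (hsum : ∑ Λ, a Λ * Λ.card ≤ N₁)
    (hnear : ∀ Λ, ∑ Λ' ∈ Finset.univ.filter (fun Λ' => Near r Λ Λ'), a Λ' ≤ Λ.card * D) :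
    (ω * NormedSpace.exp ((t : ℂ) • ∑ Λ, h Λ)).trace.re ≤
      Real.exp (N₁ / ℓ * t * (Real.exp (D * ℓ * t) - 1)) +
        C * Real.exp (-r / ξ) * Real.exp (t * ∑ Λ, a Λ) := by
  have hann : ∀ Λ, 0 ≤ a Λ := fun Λ => (opNorm_nonneg _).trans (ha Λ)
  have hN₁ : 0 ≤ N₁ :=
    (Finset.sum_nonneg fun Λ _ => mul_nonneg (hann Λ) (Nat.cast_nonneg _)).trans hsum
  set X := ∑ Λ, h Λ
  have hseries := NormedSpace.exp_series_hasSum_exp' (𝕂 := ℂ) ((t : ℂ) • X)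
  let φ : Op V q →+ ℝ :=
    { toFun := fun M => (ω * M).trace.re
      map_zero' := by simp
      map_add' := fun M M' => by rw [mul_add, trace_add, Complex.add_re] }
  have hφ : Continuous φ := Complex.continuous_re.comp
    ((continuous_const.mul continuous_id).matrix_trace)
  have hseries' := (hseries.map φ hφ).tendsto_sum_nat
  refine le_of_tendsto' hseries' fun M => ?_
  have hterm : ∀ m, (φ ∘ fun n : ℕ => ((n.factorial : ℂ)⁻¹ • ((t : ℂ) • X) ^ n)) m ≤
      t ^ m / (m.factorial : ℝ) * noIsolatedWeight a (Near r) (Fin m) +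
        C * Real.exp (-r / ξ) * ((t * ∑ Λ, a Λ) ^ m / (m.factorial : ℝ)) := fun m => by
    have h₁ : (φ ∘ fun n : ℕ => ((n.factorial : ℂ)⁻¹ • ((t : ℂ) • X) ^ n)) m =
        t ^ m / (m.factorial : ℝ) * (ω * X ^ m).trace.re := by
      simp only [Function.comp, φ, AddMonoidHom.coe_mk, ZeroHom.coe_mk]
      rw [smul_pow, smul_smul, Matrix.mul_smul, trace_smul, smul_eq_mul]
      have : ((m.factorial : ℂ)⁻¹ * (t : ℂ) ^ m) = ((t ^ m / (m.factorial : ℝ) : ℝ) : ℂ) := by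
        push_cast; rw [div_eq_inv_mul]
      rw [this, Complex.re_ofReal_mul]
    rw [h₁]
    refine (mul_le_mul_of_nonneg_left
      (re_trace_sum_pow_le hω hC hξ hcorr hr hobs ha h0 hempty m) (by positivity)).trans
      (le_of_eq ?_)
    rw [mul_pow]; ring
  refine (Finset.sum_le_sum fun m _ => hterm m).trans ?_
  rw [Finset.sum_add_distrib, ← Finset.mul_sum]
  have hsa : 0 ≤ ∑ Λ, a Λ := Finset.sum_nonneg fun Λ _ => hann Λ
  refine add_le_add ?_ (mul_le_mul_of_nonneg_left
    (Real.sum_le_exp_of_nonneg (mul_nonneg ht hsa) M) (by positivity))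
  -- A term has near terms of total weight at most |Λ|D. One factor |Λ| is kept, to be summed to N₁,
  -- and only the other b − 1 are bounded by ℓ; hence the prefactor N₁/ℓ.
  have hbase : ∀ b : ℕ, b ≠ 0 → ∑ Λ : Finset V, a Λ * ((Λ.card : ℝ) * D) ^ b ≤
      N₁ / ℓ * (D * ℓ) ^ b := by
    intro b hb
    obtain ⟨b, rfl⟩ := Nat.exists_eq_succ_of_ne_zero hb
    have h₁ : ∀ Λ : Finset V, a Λ * ((Λ.card : ℝ) * D) ^ (b + 1) ≤
        (a Λ * Λ.card) * (D ^ (b + 1) * ℓ ^ b) := by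
      intro Λ
      rcases eq_or_ne (a Λ) 0 with h | h
      · simp [h]
      · have h₂ : (Λ.card : ℝ) ^ b ≤ ℓ ^ b := pow_le_pow_left₀ (Nat.cast_nonneg _) (hsmall Λ h) b
        have h₃ : 0 ≤ (a Λ * Λ.card) * D ^ (b + 1) :=
          mul_nonneg (mul_nonneg (hann Λ) (Nat.cast_nonneg _)) (by positivity)
        calc _ = (a Λ * Λ.card) * D ^ (b + 1) * (Λ.card : ℝ) ^ b := by rw [mul_pow]; ring
          _ ≤ (a Λ * Λ.card) * D ^ (b + 1) * ℓ ^ b := mul_le_mul_of_nonneg_left h₂ h₃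
          _ = _ := by ring
    refine (Finset.sum_le_sum fun Λ _ => h₁ Λ).trans ?_
    rw [← Finset.sum_mul]
    refine (mul_le_mul_of_nonneg_right hsum (by positivity)).trans (le_of_eq ?_)
    simp only [Nat.succ_eq_add_one, mul_pow]
    field_simp
    ring
  refine sum_div_factorial_le_exp _
    (fun b => if b = 0 then 0 else ((b : ℝ) + 1) * ∑ Λ : Finset V, a Λ * ((Λ.card : ℝ) * D) ^ b)
    (N₁ / ℓ) (D * ℓ) (by positivity) (by positivity)
    (fun m => noIsolatedWeight_nonneg hann _ _) ?_ (by simp) (fun b => ?_) (fun b => ?_)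
    (noIsolatedWeight_succ_le hann (Near r) (fun _ _ => Near.symm)
      (fun Λ => (Λ.card : ℝ) * D) (fun Λ => by convert hnear Λ)) ht M
  · simp only [noIsolatedWeight, Finset.univ_unique, Finset.sum_singleton, Finset.univ_eq_empty,
      Finset.prod_empty]
    split_ifs <;> norm_num
  · split_ifs with hb
    · positivity
    · calc _ ≤ ((b : ℝ) + 1) * (N₁ / ℓ * (D * ℓ) ^ b) :=
          mul_le_mul_of_nonneg_left (hbase b hb) (by positivity)
        _ = _ := by ring
  · split_ifs
    · exact le_rfl
    · exact mul_nonneg (by positivity) (Finset.sum_nonneg fun Λ _ => mul_nonneg (hann Λ)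
        (by positivity))

end SpinSystem

end Locality

/-! ### The functions F and f, parametrised by the maximiser s. -/

section RateFunction

open Set Filter Topology

namespace SpinSystem

/-- The point `x` for which `rate x` has its maximum at `s`. -/
noncomputable def dualPoint (s : ℝ) : ℝ := (1 + s) * (Real.exp s - 1)

/-- The slope `s ↦ s (e^s - 1 / 2)` of the maximum of the rate at its maximiser. -/
noncomputable def slope (s : ℝ) : ℝ := s * (Real.exp s - 1 / 2)

theorem dualPoint_strictMonoOn : StrictMonoOn dualPoint (Ici 0) := by
  intro s hs t ht hst
  have h0 : (0 : ℝ) ≤ s := hs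
  have h1 := Real.exp_lt_exp.mpr hst
  have h2 : 0 ≤ Real.exp s - 1 := by linarith [Real.add_one_le_exp s]
  exact mul_lt_mul'' (by linarith) (by linarith) (by linarith) h2

theorem dualPoint_zero : dualPoint 0 = 0 := by simp [dualPoint]

theorem continuous_dualPoint : Continuous dualPoint := by unfold dualPoint; fun_prop

theorem exists_dualPoint_eq {x : ℝ} (hx : 0 ≤ x) : ∃ s, 0 ≤ s ∧ dualPoint s = x := by
  have h : x ≤ dualPoint x := by
    have h1 := Real.add_one_le_exp x
    unfold dualPoint
    nlinarith
  obtain ⟨s, hs, h'⟩ := intermediate_value_Icc hx continuous_dualPoint.continuousOn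
    ⟨dualPoint_zero.trans_le hx, h⟩
  exact ⟨s, hs.1, h'⟩

theorem hasDerivAt_rate (x s : ℝ) : HasDerivAt (rate x) (x - dualPoint s) s := by
  have h := (hasDerivAt_id s).mul
    ((((Real.hasDerivAt_exp s).const_sub x).add_const 1).add ((hasDerivAt_id s).div_const 2))
  refine h.congr_deriv ?_
  simp only [id, dualPoint, Pi.add_apply]
  ring

/-- The derivative at u is `dualPoint s - dualPoint u`, which changes sign exactly at s because
`dualPoint` is increasing. -/
theorem rate_lt {s t : ℝ} (hs : 0 ≤ s) (ht : 0 ≤ t) (hst : t ≠ s) :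
    rate (dualPoint s) t < rate (dualPoint s) s := by
  have hcont : Continuous (rate (dualPoint s)) :=
    continuous_iff_continuousAt.mpr fun t => (hasDerivAt_rate _ t).continuousAt
  rcases hst.lt_or_gt with h | h
  · refine strictMonoOn_of_deriv_pos (convex_Icc 0 s) hcont.continuousOn (fun u hu => ?_)
      ⟨ht, h.le⟩ ⟨hs, le_rfl⟩ h
    rw [interior_Icc] at hu
    rw [(hasDerivAt_rate _ u).deriv, sub_pos]
    exact dualPoint_strictMonoOn hu.1.le hs hu.2
  · refine strictAntiOn_of_deriv_neg (convex_Ici s) hcont.continuousOn (fun u hu => ?_)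
      self_mem_Ici h.le h
    rw [interior_Ici] at hu
    rw [(hasDerivAt_rate _ u).deriv, sub_neg]
    exact dualPoint_strictMonoOn hs (hs.trans (le_of_lt hu)) hu

theorem isMaxOn_rate {s : ℝ} (hs : 0 ≤ s) : IsMaxOn (rate (dualPoint s)) (Ici 0) s := by
  intro t ht
  rcases eq_or_ne t s with rfl | h
  · exact le_refl (rate (dualPoint t) t)
  · exact (rate_lt hs ht h).le

theorem sStar_dualPoint {s : ℝ} (hs : 0 ≤ s) : sStar (dualPoint s) = s := by
  have h : {t : ℝ | 0 ≤ t ∧ IsMaxOn (rate (dualPoint s)) (Ici 0) t} = {s} := by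
    ext t
    simp only [mem_ofPred_eq, mem_singleton_iff]
    constructor
    · rintro ⟨ht, hmax⟩
      by_contra hne
      exact absurd (hmax (mem_Ici.mpr hs)) (not_le.mpr (rate_lt hs ht hne))
    · rintro rfl
      exact ⟨hs, isMaxOn_rate hs⟩
  rw [sStar, h, csInf_singleton]

theorem F_dualPoint {s : ℝ} (hs : 0 ≤ s) : F (dualPoint s) = s * slope s := by
  have h : IsGreatest (rate (dualPoint s) '' Ici 0) (rate (dualPoint s) s) :=
    ⟨mem_image_of_mem _ hs, by rintro _ ⟨t, ht, rfl⟩; exact isMaxOn_rate hs ht⟩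
  rw [F, h.csSup_eq, rate, dualPoint, slope]
  ring

theorem slope_strictMonoOn : StrictMonoOn slope (Ici 0) := by
  intro s hs t ht hst
  have h0 : (0 : ℝ) ≤ s := hs
  have h1 := Real.exp_lt_exp.mpr hst
  have h2 : 0 ≤ Real.exp s - 1 / 2 := by linarith [Real.add_one_le_exp s]
  exact mul_lt_mul'' hst (by linarith) h0 h2

theorem slope_nonneg {s : ℝ} (hs : 0 ≤ s) : 0 ≤ slope s := by
  have h := slope_strictMonoOn.monotoneOn self_mem_Ici hs hs
  simpa [slope] using h

theorem slope_pos {s : ℝ} (hs : 0 < s) : 0 < slope s := by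
  have h := slope_strictMonoOn self_mem_Ici (mem_Ici.mpr hs.le) hs
  simpa [slope] using h

variable {A d ξ : ℝ} {k : ℕ}

theorem f_dualPoint {s w : ℝ} (hs : 0 ≤ s) (hw : k * w = dualPoint s) :
    f A d ξ k w = s * slope s / ((k : ℝ) ^ 2 * A ^ 2 *
      (ξ / (k * A ^ 2) * (k * s + s * slope s)) ^ (2 * d / (2 * d + 1))) := by
  rw [f, hw, F_dualPoint hs, sStar_dualPoint hs]

/-- The function `f` in terms of the maximiser, up to a constant. -/
noncomputable def profile (p : ℝ) (k : ℕ) (s : ℝ) : ℝ :=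
  (s * slope s) ^ (1 - p) * (slope s / (k + slope s)) ^ p

/-- Splitting su = (su)^{1−p} (su)^p and cancelling s inside the p-th power leaves two increasing
continuous factors and removes the quotient 0/0 at s = 0. -/
theorem f_eq_profile (hA : 0 < A) (hd : 1 ≤ d) (hξ : 0 < ξ) (hk : 1 ≤ k) {s w : ℝ} (hs : 0 ≤ s)
    (hw : k * w = dualPoint s) :
    f A d ξ k w = ((k : ℝ) ^ 2 * A ^ 2 * (ξ / (k * A ^ 2)) ^ (2 * d / (2 * d + 1)))⁻¹ *
      profile (2 * d / (2 * d + 1)) k s := by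
  rw [f_dualPoint hs hw, profile]
  set p := 2 * d / (2 * d + 1)
  have hp1 : 0 < 1 - p := by
    have : 1 - p = 1 / (2 * d + 1) := by simp only [p]; field_simp; ring
    rw [this]; positivity
  have hk0 : (0 : ℝ) < k := by exact_mod_cast hk
  rcases hs.eq_or_lt with rfl | hs
  · simp [Real.zero_rpow hp1.ne']
  · have hu := slope_pos hs
    have hc : 0 < ξ / (k * A ^ 2) := by positivity
    have h1 : (k : ℝ) * s + s * slope s = s * (k + slope s) := by ring
    have h2 : (slope s / (k + slope s)) ^ p = (s * slope s) ^ p / (s * (k + slope s)) ^ p := by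
      rw [← Real.div_rpow (by positivity) (by positivity), mul_div_mul_left _ _ hs.ne']
    rw [h1, Real.mul_rpow hc.le (by positivity), h2, Real.rpow_sub (by positivity), Real.rpow_one]
    have h3 : 0 < (s * slope s) ^ p := by positivity
    have h4 : 0 < (s * (k + slope s)) ^ p := by positivity
    have h5 : 0 < (ξ / (k * A ^ 2)) ^ p := by positivity
    field_simp

theorem profile_strictMonoOn {p : ℝ} (hp : 0 < p) (hp1 : p < 1) (hk : 1 ≤ k) :
    StrictMonoOn (profile p k) (Ici 0) := by
  intro s hs t ht hst
  have hs0 : (0 : ℝ) ≤ s := hs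
  have hk0 : (0 : ℝ) < k := by exact_mod_cast hk
  have hu := slope_nonneg hs
  have hv := slope_nonneg ht
  have huv := slope_strictMonoOn hs ht hst
  have h1 : s * slope s < t * slope t := mul_lt_mul'' hst huv hs hu
  have h2 : slope s / (k + slope s) < slope t / (k + slope t) := by
    rw [div_lt_div_iff₀ (by positivity) (by positivity)]
    nlinarith
  have h3 : 0 ≤ s * slope s := mul_nonneg hs hu
  have h4 : 0 ≤ slope s / (k + slope s) := by positivity
  exact mul_lt_mul'' (Real.rpow_lt_rpow h3 h1 (by linarith)) (Real.rpow_lt_rpow h4 h2 hp)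
    (Real.rpow_nonneg h3 _) (Real.rpow_nonneg h4 _)

theorem profile_zero {p : ℝ} (hp1 : p < 1) : profile p k 0 = 0 := by
  rw [profile, zero_mul, Real.zero_rpow (by linarith), zero_mul]

theorem continuousOn_profile {p : ℝ} (hp : 0 < p) (hp1 : p < 1) (hk : 1 ≤ k) :
    ContinuousOn (profile p k) (Ici 0) := by
  have hk0 : (0 : ℝ) < k := by exact_mod_cast hk
  have hu : Continuous slope := by unfold slope; fun_prop
  refine ContinuousOn.mul ?_ ?_
  · exact ((continuous_id.mul hu).rpow_const fun _ => Or.inr (by linarith)).continuousOn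
  · refine ContinuousOn.rpow_const ?_ fun _ _ => Or.inr hp.le
    refine hu.continuousOn.div (continuous_const.add hu).continuousOn fun s hs => ?_
    have := slope_nonneg hs
    positivity

theorem exists_profile_eq {p : ℝ} (hp : 0 < p) (hp1 : p < 1) (hk : 1 ≤ k) {y : ℝ} (hy : 0 ≤ y) :
    ∃ s, 0 ≤ s ∧ profile p k s = y := by
  have hk0 : (0 : ℝ) < k := by exact_mod_cast hk
  -- A minorant of `profile` for s ≥ 1, where the slope is at least 1.
  have hlim : Tendsto (fun s : ℝ => s ^ (1 - p) * (1 / (k + 1 : ℝ)) ^ p) atTop atTop :=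
    (tendsto_rpow_atTop (by linarith)).atTop_mul_const (by positivity)
  obtain ⟨S, hS1, hS⟩ := ((eventually_ge_atTop 1).and (hlim.eventually_ge_atTop y)).exists
  have hu : 1 ≤ slope S := by
    have := Real.add_one_le_exp S
    unfold slope
    nlinarith
  have hSy : y ≤ profile p k S := by
    refine hS.trans (mul_le_mul (Real.rpow_le_rpow (by linarith) (by nlinarith) (by linarith))
      (Real.rpow_le_rpow (by positivity) ?_ hp.le) (by positivity)
      (Real.rpow_nonneg (by positivity) _))
    rw [div_le_div_iff₀ (by positivity) (by positivity)]
    nlinarith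
  obtain ⟨s, hs, h⟩ := intermediate_value_Icc (by linarith : (0 : ℝ) ≤ S)
    ((continuousOn_profile hp hp1 hk).mono Icc_subset_Ici_self)
    ⟨(profile_zero hp1).trans_le hy, hSy⟩
  exact ⟨s, hs.1, h⟩

theorem exponent_mem (hd : 1 ≤ d) : 0 < 2 * d / (2 * d + 1) ∧ 2 * d / (2 * d + 1) < 1 :=
  ⟨by positivity, by rw [div_lt_one (by positivity)]; linarith⟩

theorem f_strictMonoOn (hA : 0 < A) (hd : 1 ≤ d) (hξ : 0 < ξ) (hk : 1 ≤ k) :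
    StrictMonoOn (f A d ξ k) (Ici 0) := by
  intro v hv w hw hvw
  have hk0 : (0 : ℝ) < k := by exact_mod_cast hk
  obtain ⟨s, hs, hsv⟩ := exists_dualPoint_eq (mul_nonneg hk0.le hv)
  obtain ⟨t, ht, htw⟩ := exists_dualPoint_eq (mul_nonneg hk0.le hw)
  have hst : s < t := by
    rw [← dualPoint_strictMonoOn.lt_iff_lt hs ht, hsv, htw]
    exact mul_lt_mul_of_pos_left hvw hk0
  rw [f_eq_profile hA hd hξ hk hs hsv.symm, f_eq_profile hA hd hξ hk ht htw.symm]
  obtain ⟨hp, hp1⟩ := exponent_mem hd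
  exact mul_lt_mul_of_pos_left (profile_strictMonoOn hp hp1 hk hs ht hst) (by positivity)

theorem f_zero (hA : 0 < A) (hd : 1 ≤ d) (hξ : 0 < ξ) (hk : 1 ≤ k) : f A d ξ k 0 = 0 := by
  rw [f_eq_profile hA hd hξ hk le_rfl (by rw [mul_zero, dualPoint_zero]),
    profile_zero (exponent_mem hd).2, mul_zero]

theorem f_bijOn (hA : 0 < A) (hd : 1 ≤ d) (hξ : 0 < ξ) (hk : 1 ≤ k) :
    BijOn (f A d ξ k) (Ici 0) (Ici 0) := by
  have hmono := f_strictMonoOn hA hd hξ hk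
  have hk0 : (0 : ℝ) < k := by exact_mod_cast hk
  refine ⟨fun w hw => ?_, hmono.injOn, fun y hy => ?_⟩
  · rw [mem_Ici, ← f_zero hA hd hξ hk]
    exact hmono.monotoneOn self_mem_Ici hw hw
  · obtain ⟨hp, hp1⟩ := exponent_mem hd
    have hc : 0 < (k : ℝ) ^ 2 * A ^ 2 * (ξ / (k * A ^ 2)) ^ (2 * d / (2 * d + 1)) := by positivity
    obtain ⟨s, hs, h⟩ := exists_profile_eq hp hp1 hk (mul_nonneg hc.le hy)
    have hx : 0 ≤ dualPoint s := by
      rw [← dualPoint_zero]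
      exact dualPoint_strictMonoOn.monotoneOn self_mem_Ici hs hs
    refine ⟨dualPoint s / k, div_nonneg hx hk0.le, ?_⟩
    rw [f_eq_profile hA hd hξ hk hs (mul_div_cancel₀ _ hk0.ne'), h, inv_mul_cancel_left₀ hc.ne']

theorem fInv_spec (hA : 0 < A) (hd : 1 ≤ d) (hξ : 0 < ξ) (hk : 1 ≤ k) {y : ℝ} (hy : 0 ≤ y) :
    0 ≤ fInv A d ξ k y ∧ f A d ξ k (fInv A d ξ k y) = y := by
  have h := (f_bijOn hA hd hξ hk).surjOn hy
  exact ⟨Function.invFunOn_mem h, Function.invFunOn_eq h⟩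

/-- This makes the choice of parameters admissible: it yields Dℓt ≤ 2/3. With e^s written as its
cubic Taylor polynomial plus δ ≥ 0, the difference of the two sides is quadratic in δ with
nonnegative coefficients for s > 0. -/
theorem slope_bound {s : ℝ} (hs : 0 < s) :
    3 / 2 * s * slope s ≤ (Real.exp s - 1 - s / 2) * (1 + slope s) := by
  have hE : 1 + s + s ^ 2 / 2 + s ^ 3 / 6 ≤ Real.exp s := by
    have := Real.sum_le_exp_of_nonneg hs.le 4
    simp [Finset.sum_range_succ, Nat.factorial] at this
    linarith
  obtain ⟨δ, hδ, hEδ⟩ : ∃ δ, 0 ≤ δ ∧ Real.exp s = 1 + s + s ^ 2 / 2 + s ^ 3 / 6 + δ :=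
    ⟨_, sub_nonneg.mpr hE, by ring⟩
  rw [slope, hEδ]
  have h0 : 0 ≤ 1 - 7 / 6 * s ^ 2 + s ^ 4 / 2 + s ^ 3 / 6 := by
    nlinarith [sq_nonneg (s ^ 2 - 7 / 6 + s / 6), sq_nonneg (s - 1), sq_nonneg s, mul_pos hs hs, pow_pos hs 3]
  have hpoly : 0 ≤ s / 2 * (1 - 7 / 6 * s ^ 2 + s ^ 3 / 6 + s ^ 4 / 2 + s ^ 5 / 3 + s ^ 6 / 18) := by
    have : 0 ≤ s ^ 5 / 3 + s ^ 6 / 18 := by positivity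
    exact mul_nonneg (by positivity) (by linarith)
  have hlin : 0 ≤ δ * (1 + s / 2 - s ^ 2 / 2 + 7 / 6 * s ^ 3 + s ^ 4 / 3) := by
    refine mul_nonneg hδ ?_
    nlinarith [sq_nonneg (s - 1), mul_pos hs hs, pow_pos hs 3, pow_pos hs 4, mul_nonneg hs.le (sq_nonneg (s - 1))]
  nlinarith [mul_nonneg hs.le (mul_nonneg hδ hδ)]

end SpinSystem

end RateFunction

/-! ### The transportation-cost inequality and the choice of its parameters. -/

section Transport

open Matrix
open scoped Matrix.Norms.L2Operator

namespace SpinSystem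

variable {V : Type*} [Fintype V] [DecidableEq V] {q : ℕ}

theorem IsState.nonempty {ρ : Op V q} (hρ : IsState ρ) : Nonempty (V → Fin q) := by
  by_contra h0
  rw [not_nonempty_iff] at h0
  have := hρ.2
  simp [trace] at this

theorem opNorm_smul (c : ℂ) (X : Op V q) : opNorm (c • X) = ‖c‖ * opNorm X := norm_smul c X

theorem opNorm_sub_le (X Y : Op V q) : opNorm (X - Y) ≤ opNorm X + opNorm Y :=
  norm_sub_le (E := Matrix (V → Fin q) (V → Fin q) ℂ) X Y

theorem sum_mul_card_eq (a : Finset V → ℝ) : ∑ Λ : Finset V, a Λ * Λ.card =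
    ∑ x : V, ∑ Λ ∈ Finset.univ.filter (fun Λ : Finset V => x ∈ Λ), a Λ := by
  simp only [Finset.sum_filter]
  rw [Finset.sum_comm]
  refine Finset.sum_congr rfl fun Λ _ => ?_
  rw [Finset.sum_ite_mem, Finset.univ_inter, Finset.sum_const, nsmul_eq_mul, mul_comm]

open Classical in
-- Every near region contains a spin in the r-ball of some spin of Λ. There are at most |Λ|D such
-- spins counted with repetition, and each carries weight at most 1.
theorem sum_near_le [MetricSpace V] {r D : ℝ} {a : Finset V → ℝ} (ha : ∀ Λ, 0 ≤ a Λ)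
    (hloc : ∀ x, ∑ Λ ∈ Finset.univ.filter (fun Λ : Finset V => x ∈ Λ), a Λ ≤ 1)
    (hball : ∀ v : V, ((Metric.closedBall v r).ncard : ℝ) ≤ D) (Λ : Finset V) :
    ∑ Λ' ∈ Finset.univ.filter (fun Λ' => Near r Λ Λ'), a Λ' ≤ Λ.card * D := by
  let ball : V → Finset V := fun x => Finset.univ.filter fun y => dist y x ≤ r
  have hcard : ∀ x, ((ball x).card : ℝ) ≤ D := fun x => by
    have h : (Metric.closedBall x r) = (ball x : Set V) := by ext y; simp [ball]
    have := hball x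
    rwa [h, Set.ncard_coe_finset] at this
  have h₁ : ∀ Λ', Near r Λ Λ' → a Λ' ≤ ∑ x ∈ Λ, ∑ y ∈ ball x, if y ∈ Λ' then a Λ' else 0 := by
    rintro Λ' ⟨x, hx, y, hy, hxy⟩
    have hnn : ∀ y, 0 ≤ if y ∈ Λ' then a Λ' else 0 := fun y => by
      split_ifs
      · exact ha Λ'
      · exact le_rfl
    refine le_trans ?_ (Finset.single_le_sum (f := fun x => ∑ y ∈ ball x, if y ∈ Λ' then a Λ' else 0)
      (fun x _ => Finset.sum_nonneg fun y _ => hnn y) hx)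
    refine le_trans ?_ (Finset.single_le_sum (f := fun y => if y ∈ Λ' then a Λ' else 0)
      (fun y _ => hnn y) (by simpa [ball, dist_comm] using hxy : y ∈ ball x))
    rw [if_pos hy]
  calc _ ≤ ∑ Λ' ∈ Finset.univ.filter (fun Λ' => Near r Λ Λ'),
        ∑ x ∈ Λ, ∑ y ∈ ball x, if y ∈ Λ' then a Λ' else 0 :=
        Finset.sum_le_sum fun Λ' hΛ' => h₁ Λ' (Finset.mem_filter.mp hΛ').2
    _ ≤ ∑ Λ', ∑ x ∈ Λ, ∑ y ∈ ball x, if y ∈ Λ' then a Λ' else 0 :=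
        Finset.sum_le_sum_of_subset_of_nonneg (Finset.filter_subset _ _) fun Λ' _ _ =>
          Finset.sum_nonneg fun x _ => Finset.sum_nonneg fun y _ => by
            split_ifs
            · exact ha Λ'
            · exact le_rfl
    _ = ∑ x ∈ Λ, ∑ y ∈ ball x, ∑ Λ', if y ∈ Λ' then a Λ' else 0 := by
        rw [Finset.sum_comm]
        exact Finset.sum_congr rfl fun x _ => Finset.sum_comm
    _ ≤ ∑ x ∈ Λ, ∑ y ∈ ball x, 1 := by
        refine Finset.sum_le_sum fun x _ => Finset.sum_le_sum fun y _ => ?_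
        rw [← Finset.sum_filter]
        exact hloc y
    _ ≤ ∑ x ∈ Λ, D := Finset.sum_le_sum fun x _ => by simpa using hcard x
    _ = _ := by rw [Finset.sum_const, nsmul_eq_mul]

theorem IsState.ofReal_re_trace_mul {ω h : Op V q} (hω : IsState ω) (hh : h.IsHermitian) :
    (((ω * h).trace.re : ℝ) : ℂ) = (ω * h).trace := by
  have h1 : star (ω * h).trace = (ω * h).trace := by
    rw [← trace_conjTranspose, conjTranspose_mul, hω.1.1.eq, hh.eq, trace_mul_comm]
  exact Complex.conj_eq_iff_re.mp h1

/-- The observable `h` shifted so that its expectation value in the state `ω` vanishes. -/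
noncomputable def centred (ω h : Op V q) : Op V q := h - ((ω * h).trace.re : ℂ) • 1

theorem isObservableOn_centred {ω h : Op V q} {Λ : Finset V} (hh : IsObservableOn Λ h) :
    IsObservableOn Λ (centred ω h) := by
  refine ⟨?_, hh.2.sub (ActsOn.one.smul _)⟩
  rw [IsHermitian, centred, conjTranspose_sub, hh.1.eq, conjTranspose_smul, conjTranspose_one]
  simp

theorem opNorm_centred_le {ω h : Op V q} (hω : IsState ω) : opNorm (centred ω h) ≤ 2 * opNorm h := by
  have h1 : ‖((ω * h).trace.re : ℂ)‖ ≤ opNorm h := by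
    rw [Complex.norm_real]
    exact (Complex.abs_re_le_norm _).trans (hω.norm_trace_mul_le h)
  calc opNorm (centred ω h) ≤ opNorm h + opNorm (((ω * h).trace.re : ℂ) • (1 : Op V q)) :=
        opNorm_sub_le _ _
    _ ≤ opNorm h + opNorm h * 1 := by
        rw [opNorm_smul]
        exact add_le_add_right (mul_le_mul h1 opNorm_one_le (opNorm_nonneg _) (opNorm_nonneg _)) _
    _ = _ := by ring

theorem trace_mul_centred {ω h : Op V q} (hω : IsState ω) (hh : h.IsHermitian) :
    (ω * centred ω h).trace = 0 := by
  rw [centred, mul_sub, trace_sub, Matrix.mul_smul, mul_one, trace_smul, hω.2, smul_eq_mul, mul_one,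
    hω.ofReal_re_trace_mul hh, sub_self]

theorem re_trace_mul_centred {ρ ω h : Op V q} (hρ : IsState ρ) :
    (ρ * centred ω h).trace.re = ((ρ - ω) * h).trace.re := by
  rw [centred, mul_sub, trace_sub, Matrix.mul_smul, mul_one, trace_smul, hρ.2, sub_mul, trace_sub]
  simp

theorem trace_sub_mul_of_actsOn_empty {ρ ω h : Op V q} (hρ : IsState ρ) (hω : IsState ω)
    (hh : ActsOn ∅ h) : ((ρ - ω) * h).trace = 0 := by
  obtain ⟨c, rfl⟩ := hh.eq_smul_one
  rw [Matrix.mul_smul, mul_one, trace_smul, trace_sub, hρ.2, hω.2, sub_self, smul_zero]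

theorem re_trace_sub_mul_le {ρ ω : Op V q} (hρ : IsState ρ) (hω : IsState ω) (h : Op V q) :
    ((ρ - ω) * h).trace.re ≤ 2 * opNorm h := by
  rw [sub_mul, trace_sub, Complex.sub_re]
  have h1 := (Complex.re_le_norm _).trans (hρ.norm_trace_mul_le h)
  have h2 := (abs_le.mp ((Complex.abs_re_le_norm _).trans (hω.norm_trace_mul_le h))).1
  linarith

theorem exp_sub_one_le_one {z : ℝ} (hz : z ≤ 2 / 3) : Real.exp z - 1 ≤ 1 := by
  have h1 : z ≤ Real.log 2 := by linarith [Real.log_two_gt_d9]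
  have h2 := Real.exp_le_exp.mpr h1
  rw [Real.exp_log two_pos] at h2
  linarith

/-- Transportation-cost inequality with free parameters: the range `r` beyond which the spins are
treated as uncorrelated, the size `ℓ` beyond which the terms of the observable are bounded by their
norm, and the inverse temperature `t`. -/
theorem mul_re_trace_sub_mul_le [Nonempty V] [MetricSpace V] {C ξ β : ℝ} {H ρ : Op V q}
    (hC : 0 < C) (hξ : 0 < ξ) (hH : H.IsHermitian)
    (hcorr : HasCorrelationLength C ξ (gibbs β H)) (hρ : IsState ρ)
    (henergy : (ρ * H).trace = (gibbs β H * H).trace)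
    {h : Finset V → Op V q} (hobs : ∀ Λ, IsObservableOn Λ (h Λ))
    (hloc : ∀ x, ∑ Λ ∈ Finset.univ.filter (fun Λ : Finset V => x ∈ Λ), 2 * opNorm (h Λ) ≤ 1)
    {r D ℓ t : ℝ} (hr : 0 ≤ r) (hball : ∀ v : V, ((Metric.closedBall v r).ncard : ℝ) ≤ D)
    (hℓ : 0 < ℓ) (ht : 0 ≤ t) (hDℓt : D * ℓ * t ≤ 2 / 3) (htr : t * Fintype.card V ≤ r / ξ) :
    t * ((ρ - gibbs β H) * ∑ Λ, h Λ).trace.re ≤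
      entropy (gibbs β H) - entropy ρ + Real.log (C + 1) + Fintype.card V * t / ℓ := by
  classical
  have := hρ.nonempty
  have hω := isState_gibbs hH β
  set ω := gibbs β H with hωdef
  have hD : 0 ≤ D := (Nat.cast_nonneg _).trans (hball (Classical.arbitrary V))
  -- The factor 2, matching the one in the local norm, covers both the norm of the centred term and
  -- the variation of its expectation between two states.
  let a : Finset V → ℝ := fun Λ => 2 * opNorm (h Λ)
  have ha : ∀ Λ, 0 ≤ a Λ := fun Λ => mul_nonneg zero_le_two (opNorm_nonneg _)
  let small : Finset V → Prop := fun Λ => Λ ≠ ∅ ∧ (Λ.card : ℝ) ≤ ℓ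
  let h' : Finset V → Op V q := fun Λ => if small Λ then centred ω (h Λ) else 0
  let a' : Finset V → ℝ := fun Λ => if small Λ then a Λ else 0
  have ha'a : ∀ Λ, a' Λ ≤ a Λ := fun Λ => by
    simp only [a']
    split_ifs
    · exact le_rfl
    · exact ha Λ
  have ha' : ∀ Λ, 0 ≤ a' Λ := fun Λ => by
    simp only [a']
    split_ifs
    · exact ha Λ
    · exact le_rfl
  have hobs' : ∀ Λ, IsObservableOn Λ (h' Λ) := fun Λ => by
    simp only [h']
    split_ifs
    · exact isObservableOn_centred (hobs Λ)
    · exact ⟨isHermitian_zero, ActsOn.zero⟩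
  have hn' : ∀ Λ, opNorm (h' Λ) ≤ a' Λ := fun Λ => by
    simp only [h', a']
    split_ifs
    · exact opNorm_centred_le hω
    · simp [opNorm]
  have h0' : ∀ Λ, (ω * h' Λ).trace = 0 := fun Λ => by
    simp only [h']
    split_ifs
    · exact trace_mul_centred hω (hobs Λ).1
    · simp
  have hempty' : h' ∅ = 0 := by simp [h', small]
  have hcardsum : ∑ Λ : Finset V, a Λ * Λ.card ≤ Fintype.card V := by
    rw [sum_mul_card_eq]
    refine (Finset.sum_le_sum fun x _ => hloc x).trans (le_of_eq ?_)
    simp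
  have hloc' : ∀ x, ∑ Λ ∈ Finset.univ.filter (fun Λ : Finset V => x ∈ Λ), a' Λ ≤ 1 := fun x =>
    (Finset.sum_le_sum fun Λ _ => ha'a Λ).trans (hloc x)
  set N₁ := ∑ Λ : Finset V, a' Λ * Λ.card with hN₁
  have hN₁n : N₁ ≤ Fintype.card V := (Finset.sum_le_sum fun Λ _ =>
    mul_le_mul_of_nonneg_right (ha'a Λ) (Nat.cast_nonneg _)).trans hcardsum
  have hN₁0 : 0 ≤ N₁ := Finset.sum_nonneg fun Λ _ => mul_nonneg (ha' Λ) (Nat.cast_nonneg _)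
  have hsuma' : ∑ Λ, a' Λ ≤ Fintype.card V := by
    refine le_trans (Finset.sum_le_sum fun Λ _ => ?_) hN₁n
    by_cases hs : small Λ
    · have : (1 : ℝ) ≤ Λ.card := by
        exact_mod_cast Finset.card_pos.mpr (Finset.nonempty_iff_ne_empty.mpr hs.1)
      exact le_mul_of_one_le_right (ha' Λ) this
    · simp [a', hs]
  have hmgf := re_trace_exp_le hω hC.le hξ hcorr hr hobs' hn' h0' hempty' hD hℓ ht
    (fun Λ hΛ => by
      by_contra hcon
      exact hΛ (if_neg fun hs => hcon hs.2))
    le_rfl (sum_near_le ha' hloc' hball)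
  set X := (t : ℂ) • ∑ Λ, h' Λ with hX
  have hXh : X.IsHermitian := by
    rw [hX, IsHermitian, conjTranspose_smul, conjTranspose_sum]
    simp only [(hobs' _).1.eq]
    simp
  obtain ⟨hpos, hgibbs⟩ := trace_mul_le_of_gibbs hH β hρ henergy hXh
  rw [← hωdef] at hpos hgibbs
  -- The condition Dℓt ≤ 2/3 < log 2 bounds the star contribution by exp(N₁t/ℓ), and tn ≤ r/ξ bounds
  -- the contribution of the isolated words by C.
  have hM : (ω * NormedSpace.exp X).trace.re ≤ (C + 1) * Real.exp (N₁ * t / ℓ) := by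
    refine hmgf.trans ?_
    have h1 : N₁ / ℓ * t * (Real.exp (D * ℓ * t) - 1) ≤ N₁ * t / ℓ := by
      have := mul_le_mul_of_nonneg_left (exp_sub_one_le_one hDℓt)
        (by positivity : 0 ≤ N₁ / ℓ * t)
      calc _ ≤ N₁ / ℓ * t * 1 := this
        _ = _ := by ring
    have h2 : Real.exp (-r / ξ) * Real.exp (t * ∑ Λ, a' Λ) ≤ 1 := by
      rw [← Real.exp_add, Real.exp_le_one_iff, neg_div]
      have := mul_le_mul_of_nonneg_left hsuma' ht
      linarith
    have h3 : 1 ≤ Real.exp (N₁ * t / ℓ) := Real.one_le_exp (by positivity)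
    have h4 := Real.exp_le_exp.mpr h1
    have h5 : C * Real.exp (-r / ξ) * Real.exp (t * ∑ Λ, a' Λ) ≤ C * 1 := by
      rw [mul_assoc]
      exact mul_le_mul_of_nonneg_left h2 hC.le
    nlinarith
  have hlog := Real.log_le_log hpos hM
  rw [Real.log_mul (by positivity) (Real.exp_ne_zero _), Real.log_exp] at hlog
  have hρX : (ρ * X).trace.re = t * ∑ Λ, (ρ * h' Λ).trace.re := by
    rw [hX, Matrix.mul_smul, trace_smul, smul_eq_mul, Complex.re_ofReal_mul, Finset.mul_sum,
      trace_sum, Complex.re_sum]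
  -- For a large region 1 < |Λ|/ℓ, so its cost is charged to its share of n − N₁; this complements
  -- N₁t/ℓ to nt/ℓ. The term of the empty region is a scalar and has no effect on ρ − ω.
  have hterm : ∀ Λ, ((ρ - ω) * h Λ).trace.re ≤
      (ρ * h' Λ).trace.re + (a Λ - a' Λ) * Λ.card / ℓ := fun Λ => by
    by_cases hs : small Λ
    · simp only [h', a', if_pos hs, re_trace_mul_centred hρ, sub_self, zero_mul, zero_div, add_zero]
      exact le_rfl
    · simp only [h', a', if_neg hs, mul_zero, trace_zero, Complex.zero_re, zero_add, sub_zero]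
      rcases eq_or_ne Λ ∅ with rfl | hne
      · rw [trace_sub_mul_of_actsOn_empty hρ hω (hobs ∅).2]
        simp
      · have hc : ℓ < Λ.card := by
          by_contra hcon
          exact hs ⟨hne, not_lt.mp hcon⟩
        refine (re_trace_sub_mul_le hρ hω _).trans ?_
        rw [le_div_iff₀ hℓ]
        exact mul_le_mul_of_nonneg_left hc.le (ha Λ)
  have hsum : ((ρ - ω) * ∑ Λ, h Λ).trace.re ≤
      ∑ Λ, (ρ * h' Λ).trace.re + (Fintype.card V - N₁) / ℓ := by
    rw [Finset.mul_sum, trace_sum, Complex.re_sum]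
    refine (Finset.sum_le_sum fun Λ _ => hterm Λ).trans ?_
    rw [Finset.sum_add_distrib, ← Finset.sum_div]
    simp only [sub_mul, Finset.sum_sub_distrib]
    rw [← hN₁]
    gcongr
  calc _ ≤ t * (∑ Λ, (ρ * h' Λ).trace.re + (Fintype.card V - N₁) / ℓ) :=
        mul_le_mul_of_nonneg_left hsum ht
    _ = (ρ * X).trace.re + (Fintype.card V - N₁) / ℓ * t := by rw [hρX]; ring
    _ ≤ entropy ω - entropy ρ + (Real.log (C + 1) + N₁ * t / ℓ) +
        (Fintype.card V - N₁) / ℓ * t := by linarith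
    _ = _ := by ring

theorem entropy_le_entropy_gibbs [Nonempty V] {H ρ : Op V q} (hH : H.IsHermitian) (β : ℝ)
    (hρ : IsState ρ) (henergy : (ρ * H).trace = (gibbs β H * H).trace) :
    entropy ρ ≤ entropy (gibbs β H) := by
  have := hρ.nonempty
  have h := (trace_mul_le_of_gibbs hH β hρ henergy isHermitian_zero).2
  rw [mul_zero, trace_zero, NormedSpace.exp_zero, mul_one, (isState_gibbs hH β).2] at h
  simpa using h

omit [DecidableEq V] in
theorem BallGrowth.one_le [Nonempty V] [MetricSpace V] {A d : ℝ} (h : BallGrowth V A d) :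
    1 ≤ A := by
  have h1 := h (Classical.arbitrary V) 1 le_rfl
  rw [Real.one_rpow, mul_one] at h1
  refine le_trans ?_ h1
  have : 0 < (Metric.closedBall (Classical.arbitrary V) (1 : ℝ)).ncard :=
    (Set.ncard_pos (Set.toFinite _)).mpr ⟨_, Metric.mem_closedBall_self zero_le_one⟩
  exact_mod_cast this

/-- The distance at which the correlations are as small as the error terms allow. -/
theorem exists_range {n d A ξ κ T : ℝ} (hn : 0 < n) (hd : 1 ≤ d) (hA : 0 < A) (hξ : 0 < ξ)
    (hκ : 0 < κ) (hT : 0 < T) :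
    ∃ r : ℝ, 0 < r ∧ r / ξ = n * T / (κ * (A * r ^ d) ^ 2) ∧
      ∀ G : ℝ, G / (κ ^ 2 * A ^ 2 * (ξ / (κ * A ^ 2) * T) ^ (2 * d / (2 * d + 1))) *
        n ^ (1 / (2 * d + 1)) = n * G / (κ ^ 2 * (A * r ^ d) ^ 2) := by
  have hB : 0 < ξ / (κ * A ^ 2) * T := by positivity
  obtain ⟨B, hBdef⟩ : ∃ B, B = ξ / (κ * A ^ 2) * T := ⟨_, rfl⟩
  rw [← hBdef] at hB ⊢
  have hd' : 0 < 2 * d + 1 := by linarith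
  -- The solution of r · r^{2d} = nB. Then (A r^d)² carries the powers 2d/(2d+1) of n and B, which
  -- is the origin of the exponent in f.
  obtain ⟨r, hr, hrpow⟩ : ∃ r : ℝ, 0 < r ∧ r = (n * B) ^ (1 / (2 * d + 1)) :=
    ⟨_, by positivity, rfl⟩
  have hr2d : r ^ (2 * d) = n ^ (2 * d / (2 * d + 1)) * B ^ (2 * d / (2 * d + 1)) := by
    rw [hrpow, ← Real.rpow_mul (by positivity), ← Real.mul_rpow hn.le hB.le]
    congr 1; ring
  have hr2d1 : r * r ^ (2 * d) = n * B := by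
    have h1 : r ^ (2 * d + 1) = n * B := by
      rw [hrpow, ← Real.rpow_mul (by positivity), one_div, inv_mul_cancel₀ hd'.ne', Real.rpow_one]
    rw [← h1, Real.rpow_add hr, Real.rpow_one, mul_comm]
  have hD2 : (A * r ^ d) ^ 2 = A ^ 2 * r ^ (2 * d) := by
    rw [mul_pow, ← Real.rpow_natCast (r ^ d) 2, ← Real.rpow_mul hr.le]
    congr 2; push_cast; ring
  refine ⟨r, hr, ?_, fun G => ?_⟩
  · have h2 : r = n * B / r ^ (2 * d) := by
      rw [← hr2d1, mul_div_cancel_right₀]; positivity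
    rw [hD2, div_eq_iff hξ.ne']
    conv_lhs => rw [h2, hBdef]
    have : 0 < r ^ (2 * d) := by positivity
    field_simp
  · have hnn : n ^ (1 / (2 * d + 1)) * n ^ (2 * d / (2 * d + 1)) = n := by
      rw [← Real.rpow_add hn, ← add_div, add_comm, div_self hd'.ne', Real.rpow_one]
    have h3 : 0 < n ^ (2 * d / (2 * d + 1)) := by positivity
    have h4 : 0 < B ^ (2 * d / (2 * d + 1)) := by positivity
    rw [hD2, hr2d, div_mul_eq_mul_div, div_eq_div_iff (by positivity) (by positivity)]
    linear_combination (κ ^ 2 * A ^ 2 * B ^ (2 * d / (2 * d + 1)) * G) * hnn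

/-- The choice of the parameters in the transportation-cost inequality. -/
theorem parameters_spec {κ A d ξ n S L s w r D : ℝ} (hκ : 1 ≤ κ) (hA1 : 1 ≤ A) (hd : 1 ≤ d)
    (hn : 0 < n) (hS : 0 ≤ S) (hs : 0 < s) (hsw : κ * w = dualPoint s) (hr : 0 < r)
    (hD : D = A * r ^ d) (hrξ : r / ξ = n * (κ * s + s * slope s) / (κ * D ^ 2))
    (hbudget : S + max L (1 / ξ) = n * (s * slope s) / (κ ^ 2 * D ^ 2)) :
    ∃ ℓ t : ℝ, 1 ≤ r ∧ 0 < ℓ ∧ 0 < t ∧ D * ℓ * t ≤ 2 / 3 ∧ t * n ≤ r / ξ ∧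
      S + L + n * t / ℓ ≤ t * (n * w) := by
  have hκ0 : 0 < κ := by linarith
  have hu := slope_pos hs
  have hslope := slope_bound hs
  -- With u the slope and g = e^s − 1 − s/2 this reads κw = u + g: of t·nw, the part with u pays for
  -- the entropy and the maximum, the part with g for nt/ℓ.
  have hidentity : s * slope s = s * (κ * w - (Real.exp s - 1 - s / 2)) := by
    rw [hsw, dualPoint, slope]; ring
  obtain ⟨u, hudef⟩ : ∃ u, u = slope s := ⟨_, rfl⟩
  obtain ⟨g, hg⟩ : ∃ g, g = Real.exp s - 1 - s / 2 := ⟨_, rfl⟩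
  rw [← hudef] at hu hslope hrξ hbudget hidentity
  rw [← hg] at hslope hidentity
  clear hudef hg
  have hD0 : 0 < D := by rw [hD]; positivity
  -- The term 1/ξ in the maximum is used here: comparing it with the formula for r/ξ keeps r at
  -- least 1, as the ball growth requires, and gives D ≥ r ≥ (1 + u)/u.
  have hru : (1 + u) / u ≤ r := by
    have hξbudget : 1 / ξ ≤ n * (s * u) / (κ ^ 2 * D ^ 2) := by
      rw [← hbudget]
      linarith [le_max_right L (1 / ξ)]
    have h6 : r * (1 / ξ) = n * (κ * s + s * u) / (κ * D ^ 2) := by rw [← hrξ]; ring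
    have h7 := mul_le_mul_of_nonneg_left hξbudget hr.le
    rw [h6] at h7
    have h8 : n * (κ * s + s * u) / (κ * D ^ 2) = κ * (κ + u) * (n * s / (κ ^ 2 * D ^ 2)) := by
      field_simp
    have h9 : r * (n * (s * u) / (κ ^ 2 * D ^ 2)) = r * u * (n * s / (κ ^ 2 * D ^ 2)) := by ring
    rw [h8, h9] at h7
    rw [div_le_iff₀ hu]
    refine le_trans ?_ (le_of_mul_le_mul_right h7 (by positivity))
    exact (add_le_add_left hκ u).trans (le_mul_of_one_le_left (by linarith) hκ)
  have hr1 : 1 ≤ r := le_trans (by rw [le_div_iff₀ hu]; linarith) hru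
  have hDr : r ≤ D := by
    have h10 : r ≤ r ^ d := by
      conv_lhs => rw [← Real.rpow_one r]
      exact Real.rpow_le_rpow_of_exponent_le hr1 hd
    rw [hD]
    exact h10.trans (le_mul_of_one_le_left (by linarith) hA1)
  have hg0 : 0 < g := by
    have h11 : 0 < g * (1 + u) := lt_of_lt_of_le (by positivity) hslope
    exact pos_of_mul_pos_left h11 (by linarith)
  have hgD : 3 / 2 * s ≤ g * D := by
    have h12 : (1 + u) / u ≤ D := hru.trans hDr
    rw [div_le_iff₀ hu] at h12
    have h13 := mul_le_mul_of_nonneg_left h12 hg0.le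
    rw [← mul_assoc] at h13
    exact le_of_mul_le_mul_right (hslope.trans h13) hu
  refine ⟨κ / g, s / (κ * D ^ 2), hr1, by positivity, by positivity, ?_, ?_, ?_⟩
  · have h13 : D * (κ / g) * (s / (κ * D ^ 2)) = s / (g * D) := by field_simp
    rw [h13, div_le_iff₀ (by positivity)]
    linarith
  · rw [hrξ, div_mul_eq_mul_div]
    refine div_le_div_of_nonneg_right ?_ (by positivity)
    have h13 : 0 ≤ s * u := by positivity
    have h14 : s ≤ κ * s := le_mul_of_one_le_left hs.le hκ
    rw [mul_comm]
    exact mul_le_mul_of_nonneg_left (by linarith) hn.le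
  · have h14 : n * (s / (κ * D ^ 2)) / (κ / g) = n * (s * g) / (κ ^ 2 * D ^ 2) := by field_simp
    have h15 : s / (κ * D ^ 2) * (n * w) =
        n * (s * u) / (κ ^ 2 * D ^ 2) + n * (s * g) / (κ ^ 2 * D ^ 2) := by
      rw [hidentity]; field_simp; ring
    have h16 := le_max_left L (1 / ξ)
    rw [h14, h15]
    linarith

theorem exists_parameters {k : ℕ} (hk : 1 ≤ k) {A d ξ n S L y : ℝ} (hA1 : 1 ≤ A) (hd : 1 ≤ d)
    (hξ : 0 < ξ) (hn : 0 < n) (hS : 0 ≤ S)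
    (hy : y * n ^ (1 / (2 * d + 1)) = S + max L (1 / ξ)) :
    ∃ r ℓ t : ℝ, 1 ≤ r ∧ 0 < ℓ ∧ 0 < t ∧ A * r ^ d * ℓ * t ≤ 2 / 3 ∧ t * n ≤ r / ξ ∧
      S + L + n * t / ℓ ≤ t * (n * fInv A d ξ k y) := by
  have hA : 0 < A := by linarith
  have hk1 : (1 : ℝ) ≤ k := by exact_mod_cast hk
  have hk0 : (0 : ℝ) < k := by linarith
  have hy0 : 0 < y := by
    have hinvξ : 0 < 1 / ξ := by positivity
    have h1 : 0 < y * n ^ (1 / (2 * d + 1)) := by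
      rw [hy]
      linarith [le_max_right L (1 / ξ)]
    exact pos_of_mul_pos_left h1 (by positivity)
  obtain ⟨hw, hfw⟩ := fInv_spec hA hd hξ hk hy0.le
  obtain ⟨s, hs, hsw⟩ := exists_dualPoint_eq (mul_nonneg hk0.le hw)
  rw [f_dualPoint hs hsw.symm] at hfw
  have hs0 : 0 < s := by
    rcases hs.eq_or_lt with rfl | h0
    · rw [zero_mul, zero_div] at hfw
      exact absurd hfw hy0.ne
    · exact h0
  have hu := slope_pos hs0
  obtain ⟨r, hr, hrξ, hG⟩ := exists_range hn hd hA hξ hk0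
    (by positivity : 0 < k * s + s * slope s)
  rw [← hfw, hG] at hy
  obtain ⟨ℓ, t, h⟩ := parameters_spec hk1 hA1 hd hn hS hs0 hsw.symm hr rfl hrξ hy.symm
  exact ⟨r, ℓ, t, h⟩

/-- Transportation-cost inequality for the observables with local norm at most one. -/
theorem re_trace_sub_mul_le_fInv [Nonempty V] [MetricSpace V] {k : ℕ} (hk : 1 ≤ k)
    {A d C ξ β : ℝ} {H ρ : Op V q} (hd : 1 ≤ d) (hC : 0 < C) (hξ : 0 < ξ)
    (hballs : BallGrowth V A d) (hH : H.IsHermitian)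
    (hcorr : HasCorrelationLength C ξ (gibbs β H)) (hρ : IsState ρ)
    (henergy : (ρ * H).trace = (gibbs β H * H).trace)
    {h : Finset V → Op V q} (hobs : ∀ Λ, IsObservableOn Λ (h Λ))
    (hloc : ∀ x, ∑ Λ ∈ Finset.univ.filter (fun Λ : Finset V => x ∈ Λ), 2 * opNorm (h Λ) ≤ 1)
    {y : ℝ} (hy : y * (Fintype.card V : ℝ) ^ (1 / (2 * d + 1)) =
      entropy (gibbs β H) - entropy ρ + max (Real.log (C + 1)) (1 / ξ)) :
    ((ρ - gibbs β H) * ∑ Λ, h Λ).trace.re ≤ Fintype.card V * fInv A d ξ k y := by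
  obtain ⟨r, ℓ, t, hr, hℓ, ht, hDℓt, htr, hfinal⟩ := exists_parameters hk hballs.one_le hd hξ
    (by exact_mod_cast Fintype.card_pos : (0 : ℝ) < Fintype.card V)
    (sub_nonneg.mpr (entropy_le_entropy_gibbs hH β hρ henergy)) hy
  have hmain := mul_re_trace_sub_mul_le hC hξ hH hcorr hρ henergy hobs hloc
    (zero_le_one.trans hr) (fun v => hballs v r hr) hℓ ht.le hDℓt htr
  exact le_of_mul_le_mul_left (hmain.trans hfinal) ht

theorem actsOn_univ (X : Op V q) : ActsOn Finset.univ X := by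
  refine ⟨X.submatrix (fun u x => u ⟨x, Finset.mem_univ x⟩) (fun u x => u ⟨x, Finset.mem_univ x⟩), ?_⟩
  ext u v
  simp [embed]

/-- The strict inequality makes it unnecessary to know that the infimum is attained. The trivial
decomposition into one term on all of V shows that there is something to minimise over. -/
theorem locNorm_decomposition {H : Op V q} (hH : H.IsHermitian) {b : ℝ} (hb : locNorm H < 2 * b) :
    ∃ h : Finset V → Op V q, (∀ Λ, IsObservableOn Λ (h Λ)) ∧ H = ∑ Λ, h Λ ∧
      ∀ x, ∑ Λ ∈ Finset.univ.filter (fun Λ : Finset V => x ∈ Λ), opNorm (h Λ) ≤ b := by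
  rw [locNorm, mul_lt_mul_iff_right₀ two_pos] at hb
  obtain ⟨r, ⟨h, hobs, hsum, rfl⟩, hr⟩ := exists_lt_of_csInf_lt (by
    refine ⟨_, fun Λ => if Λ = Finset.univ then H else 0, fun Λ => ?_, ?_, rfl⟩
    · dsimp only
      split_ifs with hΛ
      · exact ⟨hH, hΛ ▸ actsOn_univ H⟩
      · exact ⟨isHermitian_zero, ActsOn.zero⟩
    · simp) hb
  refine ⟨h, hobs, hsum, fun x => ?_⟩
  exact (le_ciSup (f := fun x => ∑ Λ ∈ Finset.univ.filter (fun Λ : Finset V => x ∈ Λ),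
    opNorm (h Λ)) (Set.finite_range _).bddAbove x).trans hr.le

/-- A bound for the observables that decompose into terms of total norm at most one half on every
spin extends to the local norm. -/
theorem kW1loc_le {k : ℕ} {Δ : Op V q} {b : ℝ} (hb : 0 ≤ b)
    (hΔ : ∀ h : Finset V → Op V q, (∀ Λ, IsObservableOn Λ (h Λ)) →
      (∀ x, ∑ Λ ∈ Finset.univ.filter (fun Λ : Finset V => x ∈ Λ), 2 * opNorm (h Λ) ≤ 1) →
      (Δ * ∑ Λ, h Λ).trace.re ≤ b) : kW1loc k Δ ≤ b := by
  refine Real.sSup_le ?_ hb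
  rintro _ ⟨H, hH, -, hloc, rfl⟩
  refine le_of_forall_pos_le_add fun δ hδ => ?_
  -- The nearly optimal decomposition is rescaled by 1/(1 + ε); dividing by b + 1 ensures εb ≤ δ
  -- even for b = 0.
  set ε := δ / (b + 1)
  have hε : 0 < ε := by positivity
  obtain ⟨h, hobs, hsum, hx⟩ := locNorm_decomposition hH (b := (1 + ε) / 2) (by linarith)
  have h1 := hΔ (fun Λ => (((1 + ε)⁻¹ : ℝ) : ℂ) • h Λ)
    (fun Λ => ⟨by
      rw [IsHermitian, conjTranspose_smul, (hobs Λ).1.eq]; simp, (hobs Λ).2.smul _⟩)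
    (fun x => by
      have h2 : ∀ Λ, 2 * opNorm ((((1 + ε)⁻¹ : ℝ) : ℂ) • h Λ) =
          2 * (1 + ε)⁻¹ * opNorm (h Λ) := fun Λ => by
        rw [opNorm_smul, Complex.norm_real, Real.norm_of_nonneg (by positivity)]; ring
      simp only [h2]
      rw [← Finset.mul_sum]
      calc _ ≤ 2 * (1 + ε)⁻¹ * ((1 + ε) / 2) := mul_le_mul_of_nonneg_left (hx x) (by positivity)
        _ = 1 := by field_simp)
  rw [← Finset.smul_sum, ← hsum, Matrix.mul_smul, trace_smul, smul_eq_mul, Complex.re_ofReal_mul,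
    inv_mul_le_iff₀ (by positivity)] at h1
  refine h1.trans ?_
  have h3 : ε * b ≤ δ := by
    rw [div_mul_eq_mul_div, div_le_iff₀ (by positivity)]
    nlinarith
  linarith

end SpinSystem

end Transport

/-! ### Single-spin marginals and the trace norm. -/

section Marginals

open Matrix
open scoped Matrix.Norms.L2Operator

namespace SpinSystem

variable {V : Type*} [Fintype V] [DecidableEq V] {q : ℕ}

/-- The configurations of a single spin. -/
def siteEquiv (x : V) : (({x} : Finset V) → Fin q) ≃ Fin q where
  toFun u := u ⟨x, Finset.mem_singleton_self x⟩
  invFun a _ := a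
  left_inv u := by
    funext ⟨y, hy⟩
    obtain rfl := Finset.mem_singleton.mp hy
    rfl
  right_inv _ := rfl

/-- The operator `O` on the spin `x`. -/
def siteOp (x : V) (O : Matrix (Fin q) (Fin q) ℂ) : Op V q :=
  embed {x} (O.submatrix (siteEquiv x) (siteEquiv x))

theorem siteOp_mul (x : V) (O O' : Matrix (Fin q) (Fin q) ℂ) :
    siteOp x O * siteOp x O' = siteOp x (O * O') := by
  rw [siteOp, siteOp, siteOp, embed_mul, submatrix_mul_equiv]

theorem siteOp_one (x : V) : siteOp x (1 : Matrix (Fin q) (Fin q) ℂ) = 1 := by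
  rw [siteOp, submatrix_one_equiv, embed_one]

theorem siteOp_conjTranspose (x : V) (O : Matrix (Fin q) (Fin q) ℂ) :
    (siteOp x O)ᴴ = siteOp x Oᴴ := by
  rw [siteOp, siteOp, embed_conjTranspose, conjTranspose_submatrix]

/-- The partial trace is dual to O ↦ O ⊗ 1; later facts on marginals use this instead of matrix
entries. -/
theorem trace_mul_siteOp (ρ : Op V q) (x : V) (O : Matrix (Fin q) (Fin q) ℂ) :
    (ρ * siteOp x O).trace = (marginal ρ x * O).trace := by
  have h₁ : ∀ u : V → Fin q, (ρ * siteOp x O) u u =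
      ∑ b, ρ u (Function.update u x b) * O b (u x) := by
    intro u
    rw [mul_apply]
    simp only [siteOp, embed, of_apply, submatrix_apply, mul_ite, mul_zero, Finset.mem_singleton]
    rw [← Finset.sum_filter]
    refine Finset.sum_nbij' (fun v => v x) (fun b => Function.update u x b) (by simp) ?_ ?_ ?_ ?_
    · intro b _
      simp only [Finset.mem_filter, Finset.mem_univ, true_and]
      exact fun y hy => Function.update_of_ne hy _ _
    · intro v hv
      rw [Finset.mem_filter] at hv
      funext y
      by_cases hy : y = x
      · subst hy; simp
      · rw [Function.update_of_ne hy, hv.2 y hy]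
    · intro b _
      simp
    · intro v hv
      rw [Finset.mem_filter] at hv
      have : Function.update u x (v x) = v := by
        funext y
        by_cases hy : y = x
        · subst hy; simp
        · rw [Function.update_of_ne hy, hv.2 y hy]
      rw [this]
      rfl
  have h₂ : (marginal ρ x * O).trace =
      ∑ a, ∑ u ∈ Finset.univ.filter (fun u : V → Fin q => u x = a),
        ∑ b, ρ u (Function.update u x b) * O b (u x) := by
    rw [trace]
    refine Finset.sum_congr rfl fun a _ => ?_
    rw [diag_apply, mul_apply]
    simp only [marginal, of_apply, Finset.sum_mul]
    rw [Finset.sum_comm]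
    refine Finset.sum_congr rfl fun u hu => ?_
    rw [(Finset.mem_filter.mp hu).2]
  rw [h₂, Finset.sum_fiberwise, trace]
  exact Finset.sum_congr rfl fun u _ => h₁ u

theorem isHermitian_marginal {ρ : Op V q} (hρ : ρ.IsHermitian) (x : V) :
    (marginal ρ x).IsHermitian := by
  rw [IsHermitian, ext_iff_trace_mul_right]
  intro M
  have h : ((marginal ρ x)ᴴ * M).trace = star (Mᴴ * marginal ρ x).trace := by
    rw [← trace_conjTranspose, conjTranspose_mul, conjTranspose_conjTranspose]
  rw [h, trace_mul_comm, ← trace_mul_siteOp, ← trace_mul_siteOp, ← trace_conjTranspose,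
    conjTranspose_mul, siteOp_conjTranspose, conjTranspose_conjTranspose, hρ.eq, trace_mul_comm]

theorem isHermitian_avgMarginal {ρ : Op V q} (hρ : ρ.IsHermitian) :
    (avgMarginal ρ).IsHermitian := by
  rw [IsHermitian, avgMarginal, conjTranspose_smul, conjTranspose_sum]
  simp only [(isHermitian_marginal hρ _).eq]
  simp

theorem trace_avgMarginal_mul (ρ : Op V q) (O : Matrix (Fin q) (Fin q) ℂ) :
    (avgMarginal ρ * O).trace =
      ((Fintype.card V : ℂ))⁻¹ * (ρ * ∑ x, siteOp x O).trace := by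
  rw [avgMarginal, Matrix.smul_mul, trace_smul, smul_eq_mul, Finset.sum_mul, trace_sum,
    Finset.mul_sum Finset.univ (fun x => siteOp x O) ρ, trace_sum]
  simp only [trace_mul_siteOp]

/-- The trace norm of a self-adjoint matrix is attained on an observable with spectrum `{-1, 1}`. -/
theorem exists_traceNorm_eq {m : Type*} [Fintype m] [DecidableEq m] {M : Matrix m m ℂ}
    (hM : M.IsHermitian) : ∃ O : Matrix m m ℂ, O.IsHermitian ∧ O * O = 1 ∧
      traceNorm M = (M * O).trace.re := by
  obtain ⟨U, hU, hU', h⟩ := hM.exists_eq_unitary_diagonal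
  set l := hM.eigenvalues
  -- The sign of 0 is set to 1, so that O² = 1 holds also on the kernel of M.
  let ε : m → ℝ := fun i => if 0 ≤ l i then 1 else -1
  have hε : ∀ i, ε i * ε i = 1 := fun i => by simp only [ε]; split_ifs <;> norm_num
  have hlε : ∀ i, l i * ε i = |l i| := fun i => by
    simp only [ε]
    split_ifs with h0
    · rw [abs_of_nonneg h0, mul_one]
    · rw [abs_of_neg (not_le.mp h0)]; ring
  have hmul : ∀ a b : m → ℝ, U * diagonal (fun i => (a i : ℂ)) * Uᴴ *
      (U * diagonal (fun i => (b i : ℂ)) * Uᴴ) =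
        U * diagonal (fun i => ((a i * b i : ℝ) : ℂ)) * Uᴴ := fun a b => by
    have : U * diagonal (fun i => (a i : ℂ)) * Uᴴ * (U * diagonal (fun i => (b i : ℂ)) * Uᴴ) =
        U * diagonal (fun i => (a i : ℂ)) * (Uᴴ * U) * diagonal (fun i => (b i : ℂ)) * Uᴴ := by
      simp only [mul_assoc]
    rw [this, hU, mul_one, mul_assoc U, diagonal_mul_diagonal]
    simp only [Complex.ofReal_mul]
  refine ⟨U * diagonal (fun i => (ε i : ℂ)) * Uᴴ, ?_, ?_, ?_⟩
  · rw [IsHermitian, conjTranspose_mul, conjTranspose_mul, diagonal_conjTranspose,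
      conjTranspose_conjTranspose, mul_assoc]
    congr 3
    funext i
    simp
  · rw [hmul]
    simp only [hε, Complex.ofReal_one, diagonal_one, mul_one, hU']
  · have h₁ : Mᴴ * M = U * diagonal (fun i => ((l i * l i : ℝ) : ℂ)) * Uᴴ := by
      rw [hM.eq, ← hmul, ← h]
    have h₂ := (isHermitian_conjTranspose_mul_self M).sum_eigenvalues_eq hU h₁ Real.sqrt
    rw [traceNorm, h₂]
    conv_rhs => rw [h]
    rw [hmul, mul_assoc, trace_mul_comm, mul_assoc, hU, mul_one, trace_diagonal, Complex.re_sum]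
    exact Finset.sum_congr rfl fun i _ => by
      rw [Complex.ofReal_re, hlε, Real.sqrt_mul_self_eq_abs]

theorem opNorm_le_one_of_mul_self {O : Op V q} (hO : O.IsHermitian) (h : O * O = 1) :
    opNorm O ≤ 1 := norm_le_one_of_unitary (by rw [hO.eq, h])

/-- A bound for the observables that decompose into terms of total norm at most one half on every
spin extends to the average of the marginals. -/
theorem traceNorm_avgMarginal_le [Nonempty V] {ρ ω : Op V q} (hρ : ρ.IsHermitian)
    (hω : ω.IsHermitian) {b : ℝ}
    (hΔ : ∀ h : Finset V → Op V q, (∀ Λ, IsObservableOn Λ (h Λ)) →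
      (∀ x, ∑ Λ ∈ Finset.univ.filter (fun Λ : Finset V => x ∈ Λ), 2 * opNorm (h Λ) ≤ 1) →
      ((ρ - ω) * ∑ Λ, h Λ).trace.re ≤ Fintype.card V * b) :
    1 / 2 * traceNorm (avgMarginal ρ - avgMarginal ω) ≤ b := by
  obtain ⟨O, hO, hOO, htr⟩ :=
    exists_traceNorm_eq ((isHermitian_avgMarginal hρ).sub (isHermitian_avgMarginal hω))
  have hn : (0 : ℝ) < Fintype.card V := by exact_mod_cast Fintype.card_pos
  -- The test observable is half the sum of the copies of O on all the spins, assembled below as a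
  -- family on singletons. The factor 1/2 offsets the 2 in the local norm and reappears in front of
  -- the trace norm.
  let s : V → Op V q := fun x => (2⁻¹ : ℂ) • siteOp x O
  have hs : ∀ x, IsObservableOn {x} (s x) := fun x => by
    refine ⟨?_, ActsOn.smul _ ⟨_, rfl⟩⟩
    rw [IsHermitian, conjTranspose_smul, siteOp_conjTranspose, hO.eq]
    simp [s]
  have hsn : ∀ x, 2 * opNorm (s x) ≤ 1 := fun x => by
    have h1 : opNorm (siteOp x O) ≤ 1 := opNorm_le_one_of_mul_self
      (by rw [IsHermitian, siteOp_conjTranspose, hO.eq]) (by rw [siteOp_mul, hOO, siteOp_one])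
    rw [opNorm_smul]
    have h2 : ‖(2⁻¹ : ℂ)‖ = 2⁻¹ := by norm_num
    rw [h2]
    linarith
  let h : Finset V → Op V q := fun Λ => ∑ x, if Λ = {x} then s x else 0
  have hsingle : ∀ x, h {x} = s x := fun x => by
    simp [h, Finset.singleton_inj]
  have hother : ∀ Λ, (∀ x, Λ ≠ {x}) → h Λ = 0 := fun Λ hΛ =>
    Finset.sum_eq_zero fun x _ => if_neg (hΛ x)
  have hobs : ∀ Λ, IsObservableOn Λ (h Λ) := fun Λ => by
    by_cases hΛ : ∃ x, Λ = {x}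
    · obtain ⟨x, rfl⟩ := hΛ
      rw [hsingle]
      exact hs x
    · rw [hother Λ (not_exists.mp hΛ)]
      exact ⟨isHermitian_zero, ActsOn.zero⟩
  have hloc : ∀ x, ∑ Λ ∈ Finset.univ.filter (fun Λ : Finset V => x ∈ Λ), 2 * opNorm (h Λ) ≤ 1 := by
    intro x
    rw [Finset.sum_eq_single {x}]
    · rw [hsingle]
      exact hsn x
    · intro Λ hΛ hne
      rw [hother Λ ?_]
      · simp [opNorm]
      · rintro y rfl
        have := (Finset.mem_filter.mp hΛ).2
        rw [Finset.mem_singleton] at this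
        exact hne (by rw [this])
    · simp
  have hsum : ∑ Λ, h Λ = (2⁻¹ : ℂ) • ∑ x, siteOp x O := by
    simp only [h]
    rw [Finset.sum_comm, Finset.smul_sum]
    simp [s]
  have hb := hΔ h hobs hloc
  have hval : ((ρ - ω) * ∑ Λ, h Λ).trace.re =
      Fintype.card V * (1 / 2 * traceNorm (avgMarginal ρ - avgMarginal ω)) := by
    have hc : (Fintype.card V : ℂ) ≠ 0 := by exact_mod_cast Fintype.card_ne_zero
    have h1 : ((ρ - ω) * ∑ x, siteOp x O).trace =
        Fintype.card V * ((avgMarginal ρ - avgMarginal ω) * O).trace := by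
      rw [sub_mul, sub_mul, trace_sub, trace_sub, trace_avgMarginal_mul, trace_avgMarginal_mul,
        ← mul_sub, mul_inv_cancel_left₀ hc]
    rw [htr, hsum, Matrix.mul_smul, trace_smul, h1, smul_eq_mul]
    have h2 : ∀ z : ℂ, ((2⁻¹ : ℂ) * ((Fintype.card V : ℂ) * z)).re =
        Fintype.card V * (1 / 2 * z.re) := fun z => by
      have : (2⁻¹ : ℂ) * ((Fintype.card V : ℂ) * z) =
          ((2⁻¹ * (Fintype.card V : ℝ) : ℝ) : ℂ) * z := by push_cast; ring
      rw [this, Complex.re_ofReal_mul]; ring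
    exact h2 _
  rw [hval] at hb
  exact le_of_mul_le_mul_left hb hn

end SpinSystem

end Marginals

/-! ### The main theorem. -/

theorem mainTheorem6 {V : Type*} [Fintype V] [DecidableEq V] [Nonempty V] [MetricSpace V]
    (n : ℕ) (hn : Fintype.card V = n) (q k : ℕ) (hk : 1 ≤ k)
    (A d C ξ : ℝ) (hA : 0 < A) (hd : 1 ≤ d) (hC : 0 < C) (hξ : 0 < ξ)
    (hball : SpinSystem.BallGrowth V A d)
    (β : ℝ) (H : SpinSystem.Op V q) (hH : H.IsHermitian)
    (ω : SpinSystem.Op V q) (hω : ω = SpinSystem.gibbs β H)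
    (hcorr : SpinSystem.HasCorrelationLength C ξ ω)
    (ρ : SpinSystem.Op V q) (hρ : SpinSystem.IsState ρ)
    (henergy : Matrix.trace (ρ * H) = Matrix.trace (ω * H))
    (c y : ℝ) (hc : c = max (Real.log (C + 1)) (1 / ξ) / (n : ℝ) ^ (1 / (2 * d + 1)))
    (hy : y = (SpinSystem.entropy ω - SpinSystem.entropy ρ) / (n : ℝ) ^ (1 / (2 * d + 1)) + c) :
    -- `f` is an increasing bijection of `[0, ∞)` and the argument of its inverse lies in `[0, ∞)`
    (StrictMonoOn (SpinSystem.f A d ξ k) (Set.Ici 0) ∧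
      Set.BijOn (SpinSystem.f A d ξ k) (Set.Ici 0) (Set.Ici 0) ∧ 0 ≤ y) ∧
    (1 / (n : ℝ)) * SpinSystem.kW1loc k (ρ - ω) ≤ SpinSystem.fInv A d ξ k y ∧
    (1 / 2) * SpinSystem.traceNorm (SpinSystem.avgMarginal ρ - SpinSystem.avgMarginal ω) ≤
      SpinSystem.fInv A d ξ k y := by

  subst hn hω
  have hn : (0 : ℝ) < Fintype.card V := by exact_mod_cast Fintype.card_pos
  set N := (Fintype.card V : ℝ) ^ (1 / (2 * d + 1)) with hN
  have hN0 : 0 < N := Real.rpow_pos_of_pos hn _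
  have := hρ.nonempty
  have hS := SpinSystem.entropy_le_entropy_gibbs hH β hρ henergy
  have hyN : y * N = SpinSystem.entropy (SpinSystem.gibbs β H) - SpinSystem.entropy ρ +
      max (Real.log (C + 1)) (1 / ξ) := by
    rw [hy, hc, ← add_div, div_mul_cancel₀ _ hN0.ne']
  have hy0 : 0 ≤ y := by
    have h1 : 0 < 1 / ξ := by positivity
    have h2 : 0 ≤ y * N := by
      rw [hyN]
      linarith [le_max_right (Real.log (C + 1)) (1 / ξ)]
    exact nonneg_of_mul_nonneg_left h2 hN0
  have hw := (SpinSystem.fInv_spec hA hd hξ hk hy0).1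
  have hΔ : ∀ h : Finset V → SpinSystem.Op V q, (∀ Λ, SpinSystem.IsObservableOn Λ (h Λ)) →
      (∀ x, ∑ Λ ∈ Finset.univ.filter (fun Λ : Finset V => x ∈ Λ),
        2 * SpinSystem.opNorm (h Λ) ≤ 1) →
      (Matrix.trace ((ρ - SpinSystem.gibbs β H) * ∑ Λ, h Λ)).re ≤
        Fintype.card V * SpinSystem.fInv A d ξ k y := fun h hobs hloc =>
    SpinSystem.re_trace_sub_mul_le_fInv hk hd hC hξ hball hH hcorr hρ henergy hobs hloc hyN
  refine ⟨⟨SpinSystem.f_strictMonoOn hA hd hξ hk, SpinSystem.f_bijOn hA hd hξ hk, hy0⟩, ?_, ?_⟩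
  · rw [one_div_mul_eq_div, div_le_iff₀' hn]
    exact SpinSystem.kW1loc_le (mul_nonneg hn.le hw) hΔ
  · exact SpinSystem.traceNorm_avgMarginal_le hρ.1.1 (SpinSystem.isState_gibbs hH β).1.1 hΔ
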